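/- Let $C$ be a convex disc in the plane, that is, a compact convex subset of $\mathbb{R}^2$ with non-empty interior. Two sets \emph{overlap} if their interiors intersect, and \emph{touch} if they intersect but do not overlap. A \emph{dual Hadwiger family} of $C$ is a finite family of distinct translates $C+x_i$, $i\in I$, all touching $C$, such that any two translates that are consecutive (in the cyclic ordering given by the directions of the translation vectors $x_i$) are not disjoint, and such that the origin $o$ is in the convex hull of $\{x_i : i\in I\}$. A \emph{strict dual Hadwiger family} is defined in the same way, with ``are not disjoint'' replaced by ``overlap''. Such a [strict] family is \emph{minimal} if no proper subfamily of it is a [strict] dual Hadwiger family of $C$. The \emph{dual blocking number} $A(C)$ is the maximum size of a minimal dual Hadwiger family of $C$, and the \emph{strict dual blocking number} $A'(C)$ is the maximum size of a minimal strict dual Hadwiger family of $C$. Then both maxima exist, and: \begin{itemize} \item if $C$ is not a parallelogram, then $A(C)=11$ and $A'(C)=12$; \item if $C$ is a parallelogram, then $A(C)=8$ and $A'(C)=12$. \end{itemize} -/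

import Mathlib

open scoped Pointwise

noncomputable section

namespace DualBlocking

/-- The plane `ℝ²`. -/
abbrev Plane : Type := EuclideanSpace ℝ (Fin 2)

/-- A convex disc: a compact convex set in the plane with non-empty interior. -/
structure IsConvexDisc (C : Set Plane) : Prop where
  convex : Convex ℝ C
  isCompact : IsCompact C
  interior_nonempty : (interior C).Nonempty

/-- A (non-degenerate, solid) parallelogram: a translate of the parallelepiped
`{s • e 0 + t • e 1 | 0 ≤ s, t ≤ 1}` spanned by two linearly independent vectors. -/
def IsParallelogram (C : Set Plane) : Prop :=
  ∃ (p : Plane) (e : Fin 2 → Plane), LinearIndependent ℝ e ∧ C = p +ᵥ parallelepiped e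

/-- Two sets overlap if their interiors have a common point. -/
def Overlap (K L : Set Plane) : Prop := (interior K ∩ interior L).Nonempty

/-- Two sets touch if they have a common point but do not overlap. -/
def Touch (K L : Set Plane) : Prop := (K ∩ L).Nonempty ∧ ¬ Overlap K L

/-- The polar angle of a vector, in `(-π, π]`. -/
def polarAngle (v : Plane) : ℝ := Complex.arg ⟨v 0, v 1⟩

/-- The counterclockwise angle from (the direction of) `v` to (the direction of) `w`,
in `[0, 2π)`. -/
def ccwAngle (v w : Plane) : ℝ :=
  toIcoMod Real.two_pi_pos 0 (polarAngle w - polarAngle v)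

/-- `w` is the immediate successor of `v` in the counterclockwise cyclic ordering of the finite
set `F`. (It is used for sets of translation vectors of translates touching a convex disc; such
vectors are non-zero and point in pairwise distinct directions.) -/
def IsNext (F : Finset Plane) (v w : Plane) : Prop :=
  v ∈ F ∧ w ∈ F ∧ w ≠ v ∧ ∀ u ∈ F, u ≠ v → ccwAngle v w ≤ ccwAngle v u

/-- A dual Hadwiger family of `C`, given by its finite set `F` of translation vectors: all the
translates touch `C`, consecutive translates are not disjoint, and the origin is in the
convex hull of the translation vectors. -/
structure IsDualHadwigerFamily (C : Set Plane) (F : Finset Plane) : Prop where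
  touch : ∀ v ∈ F, Touch (v +ᵥ C) C
  consecutive : ∀ v w, IsNext F v w → ¬ Disjoint (v +ᵥ C) (w +ᵥ C)
  origin_mem : (0 : Plane) ∈ convexHull ℝ (F : Set Plane)

/-- A strict dual Hadwiger family of `C`: as before, but consecutive translates overlap. -/
structure IsStrictDualHadwigerFamily (C : Set Plane) (F : Finset Plane) : Prop where
  touch : ∀ v ∈ F, Touch (v +ᵥ C) C
  consecutive : ∀ v w, IsNext F v w → Overlap (v +ᵥ C) (w +ᵥ C)
  origin_mem : (0 : Plane) ∈ convexHull ℝ (F : Set Plane)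

/-- `n` is the dual blocking number `A(C)`: the maximum size of a (with respect to inclusion)
minimal dual Hadwiger family of `C`. -/
def IsDualBlockingNumber (C : Set Plane) (n : ℕ) : Prop :=
  IsGreatest {k : ℕ | ∃ F : Finset Plane, Minimal (IsDualHadwigerFamily C) F ∧ F.card = k} n

/-- `n` is the strict dual blocking number `A'(C)`: the maximum size of a (with respect to
inclusion) minimal strict dual Hadwiger family of `C`. -/
def IsStrictDualBlockingNumber (C : Set Plane) (n : ℕ) : Prop :=
  IsGreatest
    {k : ℕ | ∃ F : Finset Plane, Minimal (IsStrictDualHadwigerFamily C) F ∧ F.card = k} n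

end DualBlocking

end

open scoped Pointwise

noncomputable section

namespace DualBlocking

/-! ### Planar geometry of a unit ball: distances, supporting segments, inscribed hexagons. -/

section Seminorm

variable {E : Type*} [AddCommGroup E] [Module ℝ E] (N : Seminorm ℝ E)

/-! Let `N` be the norm with unit ball `C - C` (`IsConvexDisc.exists_isBodyNorm`). A translate
touches `C` iff its vector has norm one, and two translates meet, or overlap, iff their vectors are
at distance `≤ 1`, or `< 1`. So only `N` matters, and `N` is a maximum norm in some basis exactly
when `C` is a parallelogram.

On the unit circle the distance from a point grows with the angle up to a half turn
(`cdist_mono_right`). Hence a family is the same as a set in which every vector has a close vector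
within the next half turn (`isFamily_iff_isLinked`), and a minimal one is a cyclic sequence in which
neighbours are close while vectors two apart are not, unless they are at least a half turn apart
(`IsTightCycle.minimal`, `exists_isTightCycle`). It remains to find the largest length of such a
cycle.

Upper bounds. For every norm, three successive steps of length greater than one exceed a half turn
(`not_three_far`); as each step uses two indices, twelve indices exceed a full turn, so `n ≤ 11` in
the non-strict case. For the other bounds the circle is cut into arcs, and the number of cycle
members per arc is bounded (`IsCyclic.le_mul`): six arcs with two members each, cut by a suitable
unit hexagon; or, for a maximum norm, the four sides with two members each (non-strict) or three
(strict).

Constructions. If `N` is not a maximum norm, there is an inscribed unit hexagon none of whose edges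
extends counterclockwise along the boundary (`exists_isTightHexagon_of_hexagon`). Just after a
vertex, points are then at distance less than one from the next vertex, and points beyond the next
vertex are at distance more than one from the given vertex. Small forward perturbations of the
vertices yield cycles of length 11 and 12. For a maximum norm explicit coordinates give 8 and 12. -/

theorem seminorm_comb_le {a b : ℝ} (ha : 0 ≤ a) (hb : 0 ≤ b) (x y : E) :
    N (a • x + b • y) ≤ a * N x + b * N y := by
  refine (map_add_le_add N _ _).trans_eq ?_
  rw [map_smul_eq_mul, map_smul_eq_mul, Real.norm_of_nonneg ha, Real.norm_of_nonneg hb]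

theorem seminorm_comb_le_add {a b : ℝ} (ha : 0 ≤ a) (hb : 0 ≤ b) {x y : E}
    (hx : N x ≤ 1) (hy : N y ≤ 1) : N (a • x + b • y) ≤ a + b := by
  have := seminorm_comb_le N ha hb x y
  nlinarith

theorem seminorm_smul_of_nonneg {a : ℝ} (ha : 0 ≤ a) (x : E) : N (a • x) = a * N x := by
  rw [map_smul_eq_mul, Real.norm_of_nonneg ha]

/-- On a unit circle, the distance from a point grows with the angle. -/
theorem seminorm_sub_le_of_cone {x y z : E} (hy : N y = 1) (hx : N x = 1) (hz : N z = 1)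
    {a b : ℝ} (ha : 0 ≤ a) (hb : 0 ≤ b) (h : y = a • x + b • z) : N (x - y) ≤ N (x - z) := by
  have hs : 1 ≤ a + b := by
    rw [← hy, h]; exact seminorm_comb_le_add N ha hb hx.le hz.le
  have hs0 : 0 < a + b := by linarith
  -- The point `y / (a + b)` is where the ray of `y` meets the segment from `x` to `z`. Going
  -- through it bounds both `N (x - y)` and `N z`; in the sum of the two bounds the terms `1 / (a +
  -- b)` cancel.
  have h1 : N (x - y) ≤ (b / (a + b)) * N (x - z) + (1 - 1 / (a + b)) * N (-y) := by
    refine le_trans (le_of_eq ?_) (seminorm_comb_le N (by positivity) ?_ _ _)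
    · congr 1
      have : x = (a / (a + b)) • x + (b / (a + b)) • x := by
        rw [← add_smul, ← add_div, div_self hs0.ne', one_smul]
      have h2 : (1 / (a + b)) • y = (a / (a + b)) • x + (b / (a + b)) • z := by
        rw [h, smul_add, smul_smul, smul_smul]; congr 2 <;> ring
      calc x - y = x - (1 / (a + b)) • y + (1 - 1 / (a + b)) • (-y) := by module
        _ = _ := by
          rw [h2]; congr 1
          nth_rw 1 [this]; module
    · rw [sub_nonneg, div_le_one hs0]; exact hs
  have h2 : N z ≤ (1 / (a + b)) * N y + (a / (a + b)) * N (x - z) := by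
    rw [map_sub_rev N x z]
    refine le_trans (le_of_eq ?_) (seminorm_comb_le N (by positivity) (by positivity) _ _)
    congr 1
    have : z = (a / (a + b)) • z + (b / (a + b)) • z := by
      rw [← add_smul, ← add_div, div_self hs0.ne', one_smul]
    nth_rw 1 [this]
    rw [h, smul_add, smul_smul, smul_smul]
    have e1 : 1 / (a + b) * a = a / (a + b) := by ring
    have e2 : 1 / (a + b) * b = b / (a + b) := by ring
    rw [e1, e2]; module
  rw [map_neg_eq_map, hy] at h1
  rw [hy, hz] at h2
  have : N (x - z) = (b / (a + b)) * N (x - z) + (a / (a + b)) * N (x - z) := by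
    field_simp; ring
  linarith

/-- Three consecutive distances on a half circle cannot all exceed one. -/
theorem not_three_far {x y z : E} (hx : N x = 1) (hy : N y = 1) (hz : N z = 1) {a b : ℝ}
    (ha : 0 ≤ a) (hb : 0 ≤ b) (h : z = a • y + b • (-x)) (hxy : 1 < N (x - y))
    (hyz : 1 < N (y - z)) (hzx : 1 < N (-x - z)) : False := by
  set l := N (x - y) with hl
  have hl0 : 0 < l := by linarith
  -- This unit vector lies between `y` and `-x`, and since `l > 1` it is at distance at most one
  -- from both. So `z`, being on one side of `u`, is within one of `y` or of `-x`.
  set u : E := (1 / l) • (y - x) with hu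
  have hlu : y - x = l • u := by rw [hu, smul_smul, mul_one_div_cancel hl0.ne', one_smul]
  have hu1 : N u = 1 := by
    rw [hu, seminorm_smul_of_nonneg N (by positivity), map_sub_rev, ← hl,
      one_div_mul_cancel hl0.ne']
  have hl1 : 0 ≤ 1 - 1 / l := by rw [sub_nonneg, div_le_one hl0]; exact hxy.le
  have hl2 : 0 ≤ 1 / l := by positivity
  rcases le_total b a with hab | hab
  · have h1 := seminorm_sub_le_of_cone N hz hy hu1 (sub_nonneg.2 hab) (mul_nonneg hb hl0.le)
      (by rw [mul_smul, ← hlu, h]; module)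
    have h2 : N (y - u) ≤ 1 - 1 / l + 1 / l := by
      rw [show y - u = (1 - 1 / l) • y + (1 / l) • x by rw [hu]; module]
      exact seminorm_comb_le_add N hl1 hl2 hy.le hx.le
    linarith
  · have hx' : N (-x) = 1 := by rw [map_neg_eq_map, hx]
    have h1 := seminorm_sub_le_of_cone N hz hx' hu1 (sub_nonneg.2 hab) (mul_nonneg ha hl0.le)
      (by rw [mul_smul, ← hlu, h]; module)
    have h2 : N (-x - u) ≤ 1 - 1 / l + 1 / l := by
      rw [show -x - u = (1 - 1 / l) • (-x) + (1 / l) • (-y) by rw [hu]; module]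
      exact seminorm_comb_le_add N hl1 hl2 hx'.le (by rw [map_neg_eq_map, hy])
    linarith

/-- If a unit vector `f` is in the interior of a segment in direction `d` contained in the unit
ball, then that segment lies on a supporting line. -/
theorem abs_le_of_segment {d f : E} (hf : N f = 1) {s t : ℝ} (hs : 0 < s) (ht : 0 < t)
    (h1 : N (f + s • d) ≤ 1) (h2 : N (f - t • d) ≤ 1) (x y : ℝ) : |y| ≤ N (x • d + y • f) := by
  have key : ∀ x y : ℝ, 0 < y → y ≤ N (x • d + y • f) := by
    intro x y hy
    by_contra! hlt
    rcases le_total 0 x with hx | hx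
    · have : N ((y * t + x) • f) ≤ t * N (x • d + y • f) + x * N (f - t • d) := by
        refine le_trans (le_of_eq ?_) (seminorm_comb_le N ht.le hx _ _)
        congr 1; module
      rw [seminorm_smul_of_nonneg N (by positivity), hf] at this
      nlinarith
    · have : N ((y * s - x) • f) ≤ s * N (x • d + y • f) + (-x) * N (f + s • d) := by
        refine le_trans (le_of_eq ?_) (seminorm_comb_le N hs.le (neg_nonneg.2 hx) _ _)
        congr 1; module
      rw [seminorm_smul_of_nonneg N (by nlinarith), hf] at this
      nlinarith
  rcases lt_trichotomy y 0 with hy | hy | hy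
  · rw [abs_of_neg hy]
    have := key (-x) (-y) (neg_pos.2 hy)
    rwa [show (-x) • d + (-y) • f = -(x • d + y • f) by module, map_neg_eq_map] at this
  · rw [hy, abs_zero]; exact apply_nonneg N _
  · rw [abs_of_pos hy]; exact key x y hy

/-- The parallelogram with vertices `±(f + d)`, `±(f - d)` lies in the ball, and the midpoints `±d`,
`±f` of its sides are unit vectors. Hence its sides lie on supporting lines and the ball cannot be
larger. -/
theorem seminorm_eq_max {d f : E} (hd : N d = 1) (hf : N f = 1) (h1 : N (f + d) ≤ 1)
    (h2 : N (f - d) ≤ 1) (x y : ℝ) : N (x • d + y • f) = max |x| |y| := by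
  apply le_antisymm
  · have h : N (x • d + y • f) ≤ |(x + y) / 2| + |(y - x) / 2| := by
      rw [show x • d + y • f = ((x + y) / 2) • (f + d) + ((y - x) / 2) • (f - d) by module]
      refine (map_add_le_add N _ _).trans ?_
      rw [map_smul_eq_mul, map_smul_eq_mul, Real.norm_eq_abs, Real.norm_eq_abs]
      have := abs_nonneg ((x + y) / 2)
      have := abs_nonneg ((y - x) / 2)
      nlinarith
    refine h.trans ?_
    rcases abs_cases ((x + y) / 2) with ⟨e1, -⟩ | ⟨e1, -⟩ <;>
      rcases abs_cases ((y - x) / 2) with ⟨e2, -⟩ | ⟨e2, -⟩ <;> rw [e1, e2]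
    · exact le_max_of_le_right (by linarith [le_abs_self y])
    · exact le_max_of_le_left (by linarith [le_abs_self x])
    · exact le_max_of_le_left (by linarith [neg_abs_le x])
    · exact le_max_of_le_right (by linarith [neg_abs_le y])
  · refine max_le ?_ (abs_le_of_segment N hf one_pos one_pos (by simpa using h1)
      (by simpa using h2) x y)
    rw [add_comm]
    exact abs_le_of_segment N hd one_pos one_pos (by simpa [add_comm] using h1)
      (by rw [one_smul, map_sub_rev]; exact h2) y x

/-- If the unit hexagon `±h₀, ±h₁, ±(h₁ - h₀)` has no boundary segment from `h₀ - h₁` beyond `h₀`,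
then points between `h₀` and `h₁` are at distance less than one from `h₁`. -/
theorem seminorm_sub_lt_one_of_hexagon {h0 h1 v : E} (n0 : N h0 = 1) (n1 : N h1 = 1)
    (n2 : N (h1 - h0) = 1) (hl : ∀ l : ℝ, 0 < l → 1 < N (h0 + l • h1)) {a b : ℝ} (ha : 0 ≤ a)
    (hb : 0 < b) (hv : v = a • h0 + b • h1) (nv : N v = 1) : N (v - h1) < 1 := by
  have n2' : N (h0 - h1) = 1 := by rw [map_sub_rev, n2]
  have ha1 : a ≤ 1 := by
    have := seminorm_comb_le_add N zero_le_one hb.le nv.le n2'.le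
    rw [show (1 : ℝ) • v + b • (h0 - h1) = (a + b) • h0 by rw [hv]; module,
      seminorm_smul_of_nonneg N (by positivity), n0] at this
    linarith
  have hb1 : b ≤ 1 := by
    have := seminorm_comb_le_add N zero_le_one ha nv.le n2.le
    rw [show (1 : ℝ) • v + a • (h1 - h0) = (a + b) • h1 by rw [hv]; module,
      seminorm_smul_of_nonneg N (by positivity), n1] at this
    linarith
  have hab : 1 ≤ a + b := by
    rw [← nv, hv]; exact seminorm_comb_le_add N ha hb.le n0.le n1.le
  have ha' : a ≠ 1 := by
    rintro rfl
    have := hl b hb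
    rw [one_smul] at hv
    rw [← hv, nv] at this
    exact lt_irrefl _ this
  -- The coefficients add up to `a`, which is less than one because `a = 1` would put `v` on the
  -- excluded extension.
  have := seminorm_comb_le_add N (sub_nonneg.2 hb1) (sub_nonneg.2 hab) n2'.le n0.le
  rw [show (1 - b) • (h0 - h1) + (a + b - 1) • h0 = v - h1 by rw [hv]; module] at this
  have := lt_of_le_of_ne ha1 ha'
  linarith

/-- If the unit hexagon `±h₀, ±h₁, ±(h₁ - h₀)` has no boundary segment from `h₁` beyond
`h₁ - h₀`, then points between `h₁` and `h₁ - h₀` are at distance more than one from `h₀`. -/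
theorem one_lt_seminorm_sub_of_hexagon {h0 h1 v : E} (n0 : N h0 = 1) (n1 : N h1 = 1)
    (n2 : N (h1 - h0) = 1) (hl : ∀ l : ℝ, 0 < l → 1 < N (h1 - h0 - l • h0)) {a b : ℝ} (ha : 0 ≤ a)
    (hb : 0 < b) (hv : v = a • h1 + b • (h1 - h0)) (nv : N v = 1) : 1 < N (v - h0) := by
  by_contra! hle
  have ha1 : a ≤ 1 := by
    have := seminorm_comb_le_add N zero_le_one hb.le nv.le n0.le
    rw [show (1 : ℝ) • v + b • h0 = (a + b) • h1 by rw [hv]; module,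
      seminorm_smul_of_nonneg N (by positivity), n1] at this
    linarith
  have hab : 1 ≤ a + b := by
    rw [← nv, hv]; exact seminorm_comb_le_add N ha hb.le n1.le n2.le
  -- Together with `hab` this forces `a + b = 1`, and then `v - h0` is a point of the excluded
  -- extension.
  have h2 : b + 1 ≤ 1 + (1 - a) := by
    have := seminorm_comb_le_add N zero_le_one (sub_nonneg.2 ha1) hle n1.le
    rw [show (1 : ℝ) • (v - h0) + (1 - a) • h1 = (b + 1) • (h1 - h0) by rw [hv]; module,
      seminorm_smul_of_nonneg N (by positivity), n2] at this
    linarith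
  have hab' : a = 1 - b := by linarith
  have := hl b hb
  rw [show h1 - h0 - b • h0 = v - h0 by rw [hv, hab']; module] at this
  linarith

/-- By compactness. Parameters beyond 2 need no attention: `s • y` is the difference of `x + s • y`
and `x`, so it has norm at most 2 if both are in the ball. -/
theorem exists_maximal_extension {x y : E} (hx : N x ≤ 1) (hy : N y = 1)
    (hc : Continuous fun s : ℝ => N (x + s • y)) :
    ∃ r : ℝ, 0 ≤ r ∧ N (x + r • y) ≤ 1 ∧ ∀ s, r < s → 1 < N (x + s • y) := by
  have hcomp : IsCompact (Set.Icc (0 : ℝ) 2 ∩ {s | N (x + s • y) ≤ 1}) :=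
    isCompact_Icc.inter_right (isClosed_le hc continuous_const)
  obtain ⟨r, ⟨hr, hr1⟩, hmax⟩ := hcomp.exists_isGreatest ⟨0, ⟨by norm_num, by simpa using hx⟩⟩
  refine ⟨r, hr.1, hr1, fun s hs => ?_⟩
  by_contra! hle
  by_cases h2 : s ≤ 2
  · exact absurd (hmax ⟨⟨hr.1.trans hs.le, h2⟩, hle⟩) (not_le.2 hs)
  · have : N (s • y) ≤ N (x + s • y) + N (-x) := by
      refine le_trans (le_of_eq ?_) (map_add_le_add N _ _)
      congr 1; module
    rw [seminorm_smul_of_nonneg N (by linarith), hy, map_neg_eq_map] at this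
    linarith

end Seminorm

/-! ### Maximum norms and tight hexagons. -/

/-- The determinant of two vectors of the plane. -/
def cross (v w : Plane) : ℝ := v 0 * w 1 - v 1 * w 0

/-- The norm `N` is the maximum norm with respect to a positively oriented basis `d, f`. -/
structure IsMaxNorm (N : Seminorm ℝ Plane) (d f : Plane) : Prop where
  cross_pos : 0 < cross d f
  eq_max : ∀ x y : ℝ, N (x • d + y • f) = max |x| |y|

/-- The unit vectors `±h₀, ±h₁, ±(h₁ - h₀)` form a hexagon, and no boundary segment of the unit
ball that contains one of its edges extends this edge in the counterclockwise direction. -/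
structure IsTightHexagon (N : Seminorm ℝ Plane) (h0 h1 : Plane) : Prop where
  cross_pos : 0 < cross h0 h1
  norm_zero : N h0 = 1
  norm_one : N h1 = 1
  norm_sub : N (h1 - h0) = 1
  edge_zero : ∀ l : ℝ, 0 < l → 1 < N (h1 - h0 - l • h0)
  edge_one : ∀ l : ℝ, 0 < l → 1 < N (h0 + l • h1)
  edge_two : ∀ l : ℝ, 0 < l → 1 < N (h1 + l • (h1 - h0))

section TightHexagon

variable {N : Seminorm ℝ Plane}

/-- The segments through `f` and `d` lie on supporting lines, so the ball is contained in the
parallelogram of points whose coordinates in the basis `d, f` are at most one in absolute value.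
Follow the side through `d` to its end `d + s • f`. If `s ≥ 1`, the ball would be the whole
parallelogram; otherwise the hexagon with vertices `±f`, `±(-d + (1 - s) • f)`, `±(d + s • f)` is
tight: one edge ends by the choice of `s`, and extending either of the others leaves the
parallelogram. -/
theorem exists_isTightHexagon_of_two_long_edges (hc : Continuous N)
    (hmax : ¬ ∃ d f, IsMaxNorm N d f) {d f : Plane} (hdf : 0 < cross d f) (nd : N d = 1)
    (nf : N f = 1) (nfd : N (f - d) = 1) {m l : ℝ} (hm : 0 < m) (hl : 0 < l)
    (h1 : N (f + m • d) ≤ 1) (h2 : N (d + l • f) ≤ 1) : ∃ h0 h1, IsTightHexagon N h0 h1 := by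
  have hy : ∀ x y : ℝ, |y| ≤ N (x • d + y • f) :=
    abs_le_of_segment N nf hm one_pos h1 (by rw [one_smul, nfd])
  have hx : ∀ y x : ℝ, |x| ≤ N (y • f + x • d) :=
    abs_le_of_segment N nd hl one_pos h2 (by rw [one_smul, map_sub_rev, nfd])
  obtain ⟨s, hs0, hs1, hs⟩ := exists_maximal_extension N nd.le nf (by fun_prop)
  have hls : l ≤ s := by
    by_contra! h
    exact absurd (hs l h) (not_lt.2 h2)
  have hs2 : s < 1 := by
    by_contra! h
    refine hmax ⟨d, f, hdf, seminorm_eq_max N nd nf ?_ nfd.le⟩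
    have hspos : 0 < s := by linarith
    have := seminorm_comb_le_add N (a := 1 - 1 / s) (b := 1 / s)
      (by rw [sub_nonneg, div_le_one hspos]; exact h) (by positivity) nd.le hs1
    have e : (1 / s) • (d + s • f) = (1 / s) • d + f := by
      rw [smul_add, smul_smul, one_div_mul_cancel hspos.ne', one_smul]
    rw [e, show (1 - 1 / s) • d + ((1 / s) • d + f) = f + d by module] at this
    linarith
  refine ⟨f, -d + (1 - s) • f, ?_, nf, ?_, ?_, ?_, ?_, ?_⟩
  · have : cross f (-d + (1 - s) • f) = cross d f := by simp [cross]; ring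
    rw [this]; exact hdf
  · apply le_antisymm
    · rw [show -d + (1 - s) • f = s • (-d) + (1 - s) • (f - d) by module]
      have := seminorm_comb_le_add N hs0 (sub_nonneg.2 hs2.le) (x := -d)
        (by rw [map_neg_eq_map, nd]) nfd.le
      linarith
    · have := hx (1 - s) (-1)
      rw [show (1 - s) • f + (-1 : ℝ) • d = -d + (1 - s) • f by module] at this
      simpa using this
  · rw [show -d + (1 - s) • f - f = -(d + s • f) by module, map_neg_eq_map]
    apply le_antisymm hs1
    have := hx s 1
    rw [show s • f + (1 : ℝ) • d = d + s • f by module] at this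
    simpa using this
  · intro k hk
    rw [show -d + (1 - s) • f - f - k • f = -(d + (s + k) • f) by module, map_neg_eq_map]
    exact hs _ (by linarith)
  · intro k hk
    have := hy (-k) (1 + k * (1 - s))
    rw [show (-k) • d + (1 + k * (1 - s)) • f = f + k • (-d + (1 - s) • f) by module] at this
    have h3 := le_abs_self (1 + k * (1 - s))
    nlinarith
  · intro k hk
    have := hx ((1 - s) - k * s) (-(1 + k))
    rw [show ((1 - s) - k * s) • f + (-(1 + k)) • d =
      -d + (1 - s) • f + k • (-d + (1 - s) • f - f) by module] at this
    have h3 := neg_abs_le (-(1 + k))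
    linarith

/-- The edge from `h1` to `h1 - h0` is slid along its supporting line in direction `-h0` as far as
the ball allows. This settles that edge and the one after it. If the remaining edge still extends,
two edge directions have long segments and the previous lemma applies. -/
theorem exists_isTightHexagon_of_long_edge (hc : Continuous N)
    (hmax : ¬ ∃ d f, IsMaxNorm N d f) {h0 h1 : Plane} (hh : 0 < cross h0 h1) (n0 : N h0 = 1)
    (n1 : N h1 = 1) (n2 : N (h1 - h0) = 1) {l : ℝ} (hl : 0 < l)
    (hle : N (h1 - h0 - l • h0) ≤ 1) : ∃ h0 h1, IsTightHexagon N h0 h1 := by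
  obtain ⟨r, hr0, hr1, hr⟩ := exists_maximal_extension N (y := -h0) n2.le
    (by rw [map_neg_eq_map, n0]) (by fun_prop)
  have hlr : l ≤ r := by
    by_contra! h
    refine absurd (hr l h) (not_lt.2 ?_)
    rwa [smul_neg, ← sub_eq_add_neg]
  have hy : ∀ x y : ℝ, |y| ≤ N (x • h0 + y • (h1 - h0)) :=
    abs_le_of_segment N n2 one_pos hl (by rw [one_smul, sub_add_cancel, n1]) hle
  have nf : N (h1 - r • h0) = 1 := by
    apply le_antisymm
    · have := seminorm_comb_le_add N (a := 1 / (1 + r)) (b := r / (1 + r)) (by positivity)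
        (by positivity) n1.le hr1
      rw [show h1 - h0 + r • -h0 = h1 - (1 + r) • h0 by module, smul_sub, smul_smul,
        div_mul_cancel₀ r (by positivity : 1 + r ≠ 0), ← add_sub_assoc, ← add_smul, ← add_div,
        div_self (by positivity : 1 + r ≠ 0), one_smul] at this
      exact this
    · have := hy (1 - r) 1
      rw [show (1 - r) • h0 + (1 : ℝ) • (h1 - h0) = h1 - r • h0 by module] at this
      simpa using this
  have nfd : N (h1 - r • h0 - h0) = 1 := by
    rw [show h1 - r • h0 - h0 = h1 - h0 + r • -h0 by module]
    apply le_antisymm hr1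
    have := hy (-r) 1
    rw [show (-r) • h0 + (1 : ℝ) • (h1 - h0) = h1 - h0 + r • -h0 by module] at this
    simpa using this
  have hcr : 0 < cross h0 (h1 - r • h0) := by
    have : cross h0 (h1 - r • h0) = cross h0 h1 := by simp [cross]; ring
    rwa [this]
  by_cases hlong : ∃ k : ℝ, 0 < k ∧ N (h0 + k • (h1 - r • h0)) ≤ 1
  · obtain ⟨k, hk, hk1⟩ := hlong
    exact exists_isTightHexagon_of_two_long_edges hc hmax hcr n0 nf nfd
      (lt_of_lt_of_le hl hlr) hk (by rw [sub_add_cancel, n1]) hk1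
  · push Not at hlong
    refine ⟨h0, h1 - r • h0, hcr, n0, nf, nfd, fun k hk => ?_, hlong, fun k hk => ?_⟩
    · rw [show h1 - r • h0 - h0 - k • h0 = h1 - h0 + (r + k) • -h0 by module]
      exact hr _ (by linarith)
    · have := hy (1 - r - k * r) (1 + k)
      rw [show (1 - r - k * r) • h0 + (1 + k) • (h1 - h0) =
        h1 - r • h0 + k • (h1 - r • h0 - h0) by module] at this
      have h3 := le_abs_self (1 + k)
      linarith

/-- The relabelling `(h0, h1) ↦ (h1, h1 - h0)` permutes the edges of the hexagon cyclically up to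
sign, so one extendable edge can always be taken to be the first. -/
theorem exists_isTightHexagon_of_hexagon (hc : Continuous N)
    (hmax : ¬ ∃ d f, IsMaxNorm N d f) {h0 h1 : Plane} (hh : 0 < cross h0 h1) (n0 : N h0 = 1)
    (n1 : N h1 = 1) (n2 : N (h1 - h0) = 1) : ∃ h0 h1, IsTightHexagon N h0 h1 := by
  by_contra hno
  refine hno ⟨h0, h1, hh, n0, n1, n2, fun l hl => ?_, fun l hl => ?_, fun l hl => ?_⟩ <;>
    by_contra! hle
  · exact hno (exists_isTightHexagon_of_long_edge hc hmax hh n0 n1 n2 hl hle)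
  · have e : h1 - h0 - h1 = -h0 := by module
    refine hno (exists_isTightHexagon_of_long_edge hc hmax (h0 := h1) (h1 := h1 - h0) ?_ n1 n2
      ?_ hl ?_)
    · have : cross h1 (h1 - h0) = cross h0 h1 := by simp [cross]; ring
      rwa [this]
    · rw [e, map_neg_eq_map, n0]
    · rwa [e, show -h0 - l • h1 = -(h0 + l • h1) by module, map_neg_eq_map]
  · have e : -h0 - (h1 - h0) = -h1 := by module
    refine hno (exists_isTightHexagon_of_long_edge hc hmax (h0 := h1 - h0) (h1 := -h0) ?_ n2 ?_
      ?_ hl ?_)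
    · have : cross (h1 - h0) (-h0) = cross h0 h1 := by simp [cross]; ring
      rwa [this]
    · rw [map_neg_eq_map, n0]
    · rw [e, map_neg_eq_map, n1]
    · rwa [e, show -h1 - l • (h1 - h0) = -(h1 + l • (h1 - h0)) by module, map_neg_eq_map]

end TightHexagon

/-! ### Unit vectors in terms of polar angles. -/

section

open Real

/-- The Euclidean unit vector with polar angle `θ`. -/
def dir (θ : ℝ) : Plane := !₂[cos θ, sin θ]

@[simp] theorem dir_zero_coord (θ : ℝ) : dir θ 0 = cos θ := rfl

@[simp] theorem dir_one_coord (θ : ℝ) : dir θ 1 = sin θ := rfl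

theorem dir_ne_zero (θ : ℝ) : dir θ ≠ 0 := by
  intro h
  have h0 : cos θ = 0 := by rw [← dir_zero_coord, h]; rfl
  have h1 : sin θ = 0 := by rw [← dir_one_coord, h]; rfl
  have := sin_sq_add_cos_sq θ
  rw [h0, h1] at this
  norm_num at this

theorem dir_add_pi (θ : ℝ) : dir (θ + π) = -dir θ := by
  ext i; fin_cases i <;> simp [dir]

theorem continuous_dir : Continuous dir := by
  unfold dir
  refine (PiLp.continuous_toLp 2 _).comp (continuous_pi fun i => ?_)
  fin_cases i <;> simp <;> fun_prop

theorem sin_smul_dir (α β γ : ℝ) :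
    sin (γ - α) • dir β = sin (γ - β) • dir α + sin (β - α) • dir γ := by
  ext i; fin_cases i
  · simp [sin_sub]; ring
  · simp [sin_sub]; ring

theorem cross_dir (α β : ℝ) : cross (dir α) (dir β) = sin (β - α) := by
  simp [cross, sin_sub]; ring

/-- The unit vector, with respect to the norm `N`, with polar angle `θ`. -/
def circ (N : Seminorm ℝ Plane) (θ : ℝ) : Plane := (N (dir θ))⁻¹ • dir θ

/-- The distance between the unit vectors with given polar angles. -/
def cdist (N : Seminorm ℝ Plane) (α β : ℝ) : ℝ := N (circ N α - circ N β)

variable {N : Seminorm ℝ Plane}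

theorem circ_add_pi (θ : ℝ) : circ N (θ + π) = -circ N θ := by
  rw [circ, dir_add_pi, map_neg_eq_map, smul_neg, circ]

theorem circ_add_two_pi (θ : ℝ) : circ N (θ + 2 * π) = circ N θ := by
  rw [two_mul, ← add_assoc, circ_add_pi, circ_add_pi, neg_neg]

theorem cdist_comm (α β : ℝ) : cdist N α β = cdist N β α := map_sub_rev N _ _

theorem cdist_self (α : ℝ) : cdist N α α = 0 := by simp [cdist]

theorem cdist_add_pi (α β : ℝ) : cdist N (α + π) (β + π) = cdist N α β := by
  rw [cdist, circ_add_pi, circ_add_pi, ← neg_sub_neg, neg_neg, neg_neg, map_sub_rev, cdist,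
    map_sub_rev]

theorem cdist_add_two_pi (α β : ℝ) : cdist N (α + 2 * π) (β + 2 * π) = cdist N α β := by
  rw [two_mul, ← add_assoc, ← add_assoc, cdist_add_pi, cdist_add_pi]

theorem circ_add_nat_mul (θ : ℝ) (k : ℕ) : circ N (θ + k * (2 * π)) = circ N θ := by
  induction k with
  | zero => simp
  | succ k ih => rw [Nat.cast_succ, add_mul, one_mul, ← add_assoc, circ_add_two_pi, ih]

theorem circ_add_int_mul (θ : ℝ) (k : ℤ) : circ N (θ + k * (2 * π)) = circ N θ := by
  obtain ⟨n, rfl | rfl⟩ := k.eq_nat_or_neg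
  · exact_mod_cast circ_add_nat_mul θ n
  · conv_rhs => rw [← sub_add_cancel θ (n * (2 * π)), circ_add_nat_mul]
    congr 1; push_cast; ring

theorem seminorm_dir_pos (hN : ∀ x, N x = 0 → x = 0) (θ : ℝ) : 0 < N (dir θ) :=
  lt_of_le_of_ne (apply_nonneg N _) fun h => dir_ne_zero θ (hN _ h.symm)

theorem seminorm_circ (hN : ∀ x, N x = 0 → x = 0) (θ : ℝ) : N (circ N θ) = 1 := by
  have := seminorm_dir_pos hN θ
  rw [circ, seminorm_smul_of_nonneg N (by positivity), inv_mul_cancel₀ this.ne']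

theorem cdist_self_add_pi (hN : ∀ x, N x = 0 → x = 0) (α : ℝ) : cdist N α (α + π) = 2 := by
  rw [cdist, circ_add_pi, sub_neg_eq_add, ← two_smul ℝ, seminorm_smul_of_nonneg N zero_le_two,
    seminorm_circ hN, mul_one]

theorem cdist_le_two (hN : ∀ x, N x = 0 → x = 0) (α β : ℝ) : cdist N α β ≤ 2 := by
  refine (map_sub_le_add N _ _).trans ?_
  rw [seminorm_circ hN, seminorm_circ hN]; norm_num

theorem continuous_circ (hN : ∀ x, N x = 0 → x = 0) (hc : Continuous N) : Continuous (circ N) :=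
  ((hc.comp continuous_dir).inv₀ fun θ => (seminorm_dir_pos hN θ).ne').smul continuous_dir

theorem continuous_cdist_left (hN : ∀ x, N x = 0 → x = 0)
    (hc : Continuous N) (β : ℝ) : Continuous fun α => cdist N α β :=
  hc.comp ((continuous_circ hN hc).sub continuous_const)

theorem continuous_cdist_right (hN : ∀ x, N x = 0 → x = 0)
    (hc : Continuous N) (α : ℝ) : Continuous fun β => cdist N α β :=
  hc.comp (continuous_const.sub (continuous_circ hN hc))

theorem cross_circ_pos_iff (hN : ∀ x, N x = 0 → x = 0)
    (α β : ℝ) : 0 < cross (circ N α) (circ N β) ↔ 0 < sin (β - α) := by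
  have h1 := inv_pos.2 (seminorm_dir_pos hN α)
  have h2 := inv_pos.2 (seminorm_dir_pos hN β)
  have : cross (circ N α) (circ N β) = (N (dir α))⁻¹ * (N (dir β))⁻¹ * sin (β - α) := by
    rw [← cross_dir]; simp [cross, circ]; ring
  rw [this, mul_pos_iff_of_pos_left (mul_pos h1 h2)]

/-- Rescaling of `sin_smul_dir`. The strict positivity of each coefficient is tracked separately,
since the strict inequalities for hexagons and for open sides of a parallelogram depend on it. -/
theorem exists_cone (hN : ∀ x, N x = 0 → x = 0)
    {α β γ : ℝ} (h1 : α ≤ β) (h2 : β ≤ γ) (h3 : α < γ) (h4 : γ < α + π) :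
    ∃ a b : ℝ, 0 ≤ a ∧ 0 ≤ b ∧ (α < β → 0 < b) ∧ (β < γ → 0 < a) ∧
      circ N β = a • circ N α + b • circ N γ := by
  have hs : 0 < sin (γ - α) := sin_pos_of_pos_of_lt_pi (by linarith) (by linarith)
  have ha := seminorm_dir_pos hN α
  have hb := seminorm_dir_pos hN β
  have hg := seminorm_dir_pos hN γ
  have s1 : 0 ≤ sin (γ - β) := sin_nonneg_of_nonneg_of_le_pi (by linarith) (by linarith)
  have s2 : 0 ≤ sin (β - α) := sin_nonneg_of_nonneg_of_le_pi (by linarith) (by linarith)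
  refine ⟨sin (γ - β) / sin (γ - α) * N (dir α) / N (dir β),
    sin (β - α) / sin (γ - α) * N (dir γ) / N (dir β), by positivity, by positivity,
    fun h => ?_, fun h => ?_, ?_⟩
  · have : 0 < sin (β - α) := sin_pos_of_pos_of_lt_pi (by linarith) (by linarith)
    positivity
  · have : 0 < sin (γ - β) := sin_pos_of_pos_of_lt_pi (by linarith) (by linarith)
    positivity
  · have e : dir β = (sin (γ - β) / sin (γ - α)) • dir α + (sin (β - α) / sin (γ - α)) • dir γ := by
      rw [div_eq_inv_mul, div_eq_inv_mul, mul_smul, mul_smul, ← smul_add, ← sin_smul_dir,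
        smul_smul, inv_mul_cancel₀ hs.ne', one_smul]
    rw [circ, e, circ, circ, smul_add, smul_smul, smul_smul, smul_smul, smul_smul, ← e]
    congr 2 <;> field_simp

/-- Monotonicity on a half circle from `seminorm_sub_le_of_cone`. At exactly a half turn the cone
degenerates, but there the distance has its maximal value 2. -/
theorem cdist_mono_right (hN : ∀ x, N x = 0 → x = 0)
    {α β γ : ℝ} (h1 : α ≤ β) (h2 : β ≤ γ) (h3 : γ ≤ α + π) :
    cdist N α β ≤ cdist N α γ := by
  rcases h3.eq_or_lt with rfl | h3
  · rw [cdist_self_add_pi hN]; exact cdist_le_two hN _ _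
  rcases (h1.trans h2).eq_or_lt with rfl | h4
  · rw [le_antisymm h2 h1]
  obtain ⟨a, b, ha, hb, -, -, h⟩ := exists_cone hN h1 h2 h4 h3
  exact seminorm_sub_le_of_cone N (seminorm_circ hN _) (seminorm_circ hN _) (seminorm_circ hN _)
    ha hb h

theorem cdist_mono_left (hN : ∀ x, N x = 0 → x = 0)
    {α β γ : ℝ} (h1 : α ≤ β) (h2 : β ≤ γ) (h3 : γ ≤ α + π) :
    cdist N β γ ≤ cdist N α γ := by
  rcases h3.eq_or_lt with rfl | h3
  · rw [cdist_self_add_pi hN]; exact cdist_le_two hN _ _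
  rcases (h1.trans h2).eq_or_lt with rfl | h4
  · rw [le_antisymm h2 h1]
  obtain ⟨a, b, ha, hb, -, -, h⟩ := exists_cone hN h1 h2 h4 h3
  rw [cdist_comm β, cdist_comm α]
  exact seminorm_sub_le_of_cone N (seminorm_circ hN _) (seminorm_circ hN _) (seminorm_circ hN _)
    hb ha (by rw [h, add_comm])

theorem polarAngle_circ (hN : ∀ x, N x = 0 → x = 0)
    {θ : ℝ} (h1 : -π < θ) (h2 : θ ≤ π) : polarAngle (circ N θ) = θ := by
  have hp := inv_pos.2 (seminorm_dir_pos hN θ)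
  have : (⟨circ N θ 0, circ N θ 1⟩ : ℂ) =
      ((N (dir θ))⁻¹ : ℝ) * (Complex.cos θ + Complex.sin θ * Complex.I) := by
    apply Complex.ext <;> simp [circ, ← Complex.ofReal_cos, ← Complex.ofReal_sin]
  rw [polarAngle, this]
  exact Complex.arg_mul_cos_add_sin_mul_I hp ⟨h1, h2⟩

theorem circ_polarAngle {v : Plane} (hv : N v = 1) : circ N (polarAngle v) = v := by
  have hz : (⟨v 0, v 1⟩ : ℂ) ≠ 0 := by
    intro h
    have h0 := congrArg Complex.re h
    have h1 := congrArg Complex.im h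
    have : v = 0 := by ext i; fin_cases i <;> simp_all
    rw [this, map_zero] at hv
    exact zero_ne_one hv
  set z : ℂ := ⟨v 0, v 1⟩
  have hz' : 0 < ‖z‖ := norm_pos_iff.2 hz
  have hd : dir (polarAngle v) = ‖z‖⁻¹ • v := by
    ext i; fin_cases i
    · simp [polarAngle, Complex.cos_arg hz, z, div_eq_inv_mul]
    · simp [polarAngle, Complex.sin_arg, z, div_eq_inv_mul]
  rw [circ, hd, seminorm_smul_of_nonneg N (by positivity), hv, mul_one, inv_inv, smul_smul,
    mul_inv_cancel₀ hz'.ne', one_smul]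

theorem exists_polarAngle_circ (hN : ∀ x, N x = 0 → x = 0)
    (θ : ℝ) : ∃ k : ℤ, polarAngle (circ N θ) = θ + k * (2 * π) := by
  refine ⟨-toIocDiv two_pi_pos (-π) θ, ?_⟩
  have h := toIocMod_mem_Ioc two_pi_pos (-π) θ
  have e : toIocMod two_pi_pos (-π) θ = θ + (-toIocDiv two_pi_pos (-π) θ : ℤ) * (2 * π) := by
    rw [toIocMod, zsmul_eq_mul]; push_cast; ring
  rw [← e, ← polarAngle_circ hN h.1 (by linarith [h.2]), e, circ_add_int_mul]

theorem ccwAngle_circ (hN : ∀ x, N x = 0 → x = 0) {α β : ℝ} (h1 : α ≤ β) (h2 : β < α + 2 * π) :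
    ccwAngle (circ N α) (circ N β) = β - α := by
  obtain ⟨k, hk⟩ := exists_polarAngle_circ hN α
  obtain ⟨l, hl⟩ := exists_polarAngle_circ hN β
  rw [ccwAngle, hk, hl, show β + l * (2 * π) - (α + k * (2 * π)) = β - α + (l - k : ℤ) • (2 * π) by
    rw [zsmul_eq_mul]; push_cast; ring, toIcoMod_add_zsmul, (toIcoMod_eq_self two_pi_pos).2]
  exact ⟨by linarith, by linarith⟩

theorem eq_of_circ_eq (hN : ∀ x, N x = 0 → x = 0)
    {α β : ℝ} (h1 : α ≤ β) (h2 : β < α + 2 * π) (h : circ N α = circ N β) :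
    α = β := by
  have e1 := ccwAngle_circ hN h1 h2
  have e2 := ccwAngle_circ hN le_rfl (show α < α + 2 * π by linarith [pi_pos])
  rw [← h, e2] at e1
  linarith

theorem exists_circ_eq_of_cross_pos (hN : ∀ x, N x = 0 → x = 0) {α : ℝ} {w : Plane} (hw : N w = 1)
    (h : 0 < cross (circ N α) w) : ∃ β, α < β ∧ β < α + π ∧ circ N β = w := by
  have hm := toIocMod_mem_Ioc two_pi_pos α (polarAngle w)
  set β := toIocMod two_pi_pos α (polarAngle w) with hβ
  have e : circ N β = w := by
    rw [hβ, toIocMod, zsmul_eq_mul, sub_eq_add_neg, ← neg_mul, ← Int.cast_neg, circ_add_int_mul,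
      circ_polarAngle hw]
  refine ⟨β, hm.1, ?_, e⟩
  rw [← e, cross_circ_pos_iff hN] at h
  by_contra! hle
  have := sin_nonpos_of_nonpos_of_neg_pi_le (x := β - α - 2 * π) (by linarith [hm.2])
    (by linarith)
  rw [sin_sub_two_pi] at this
  linarith

theorem cross_circ_pos (hN : ∀ x, N x = 0 → x = 0) {α β : ℝ} (h1 : α < β) (h2 : β < α + π) :
    0 < cross (circ N α) (circ N β) := by
  rw [cross_circ_pos_iff hN]
  exact sin_pos_of_pos_of_lt_pi (by linarith) (by linarith)

theorem lt_of_cross_circ_pos (hN : ∀ x, N x = 0 → x = 0)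
    {α β : ℝ} (h1 : α - π < β) (h : 0 < cross (circ N α) (circ N β)) :
    α < β := by
  rw [cross_circ_pos_iff hN] at h
  by_contra! hle
  have := sin_nonpos_of_nonpos_of_neg_pi_le (x := β - α) (by linarith) (by linarith)
  linarith

theorem add_pi_lt_of_three_far (hN : ∀ x, N x = 0 → x = 0)
    {α β γ δ : ℝ} (h1 : α < β) (h2 : β < γ) (h3 : γ < δ)
    (f1 : β < α + π → 1 < cdist N α β) (f2 : γ < β + π → 1 < cdist N β γ)
    (f3 : δ < γ + π → 1 < cdist N γ δ) : α + π < δ := by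
  by_contra! hle
  have g1 := f1 (by linarith)
  have g2 := f2 (by linarith)
  -- If `δ` falls short of `α + π`, moving it there only increases the last distance; the
  -- configuration of `not_three_far` results.
  have g3 := (f3 (by linarith)).trans_le (cdist_mono_right hN h3.le hle (by linarith))
  obtain ⟨a, b, ha, hb, -, -, h⟩ := exists_cone hN (N := N) h2.le (show γ ≤ α + π by linarith)
    (by linarith) (by linarith)
  rw [circ_add_pi] at h
  refine not_three_far N (seminorm_circ hN α) (seminorm_circ hN β) (seminorm_circ hN γ) ha hb h
    g1 g2 ?_
  rwa [cdist_comm, cdist, circ_add_pi] at g3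

end

/-! ### Families as linked sets and as tight cycles. -/

section

open Real

/-- The conditions of a dual Hadwiger family in terms of a norm `N` on the translation vectors:
they are unit vectors, the distance of consecutive ones satisfies `r`, and the origin is in their
convex hull. -/
structure IsFamily (N : Seminorm ℝ Plane) (r : ℝ → Prop) (F : Finset Plane) : Prop where
  unit : ∀ v ∈ F, N v = 1
  consecutive : ∀ v w, IsNext F v w → r (N (v - w))
  origin_mem : (0 : Plane) ∈ convexHull ℝ (F : Set Plane)

/-- A set of unit vectors each of which has an `r`-close vector within the next half turn. -/
structure IsLinked (N : Seminorm ℝ Plane) (r : ℝ → Prop) (F : Finset Plane) : Prop where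
  nonempty : F.Nonempty
  unit : ∀ v ∈ F, N v = 1
  exists_succ : ∀ v ∈ F, ∃ w ∈ F, 0 < cross v w ∧ r (N (v - w))

/-- The angles of `n` distinct directions, continued periodically. -/
structure IsCyclic (n : ℕ) (x : ℕ → ℝ) : Prop where
  strictMono : StrictMono x
  add_period : ∀ i, x (i + n) = x i + 2 * π

/-- The unit vectors with angles `x 0, …, x (n - 1)`. -/
def cycFinset (N : Seminorm ℝ Plane) (n : ℕ) (x : ℕ → ℝ) : Finset Plane :=
  (Finset.range n).image fun i => circ N (x i)

/-- The sequence that continues `y 0, …, y (m - 1)` with `y (i + m) = y i + c`. -/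
def wrap (m : ℕ) (c : ℝ) (y : ℕ → ℝ) (i : ℕ) : ℝ := y (i % m) + (i / m : ℕ) * c

theorem wrap_of_lt {m : ℕ} {c : ℝ} {y : ℕ → ℝ} {i : ℕ} (h : i < m) : wrap m c y i = y i := by
  simp [wrap, Nat.mod_eq_of_lt h, Nat.div_eq_of_lt h]

theorem wrap_add {m : ℕ} {c : ℝ} {y : ℕ → ℝ} (hm : 0 < m) (i : ℕ) :
    wrap m c y (i + m) = wrap m c y i + c := by
  simp only [wrap, Nat.add_mod_right, Nat.add_div_right i hm]
  push_cast; ring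

theorem strictMono_wrap {m : ℕ} {c : ℝ} {y : ℕ → ℝ} (hy : ∀ i, i + 1 < m → y i < y (i + 1))
    (hc : y (m - 1) < y 0 + c) (hm : 0 < m) : StrictMono (wrap m c y) := by
  refine strictMono_nat_of_lt_succ fun i => ?_
  induction i using Nat.strong_induction_on with
  | _ i ih =>
    rcases lt_trichotomy (i + 1) m with h | h | h
    · rw [wrap_of_lt h, wrap_of_lt (by omega)]; exact hy i h
    · rw [show i + 1 = 0 + m by omega, wrap_add hm, wrap_of_lt hm, wrap_of_lt (by omega)]
      rwa [show i = m - 1 by omega]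
    · obtain ⟨j, rfl⟩ : ∃ j, i = j + m := ⟨i - m, by omega⟩
      rw [show j + m + 1 = j + 1 + m by ring, wrap_add hm, wrap_add hm]
      linarith [ih j (by omega)]

theorem forall_of_periodic {m : ℕ} {Q : ℕ → Prop} (h : ∀ i < m, Q i)
    (hQ : ∀ i, Q i → Q (i + m)) (hm : 0 < m) (i : ℕ) : Q i := by
  induction i using Nat.strong_induction_on with
  | _ i ih =>
    rcases lt_or_ge i m with hi | hi
    · exact h i hi
    · have := hQ _ (ih (i - m) (by omega))
      rwa [Nat.sub_add_cancel hi] at this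

variable {N : Seminorm ℝ Plane} {n : ℕ} {x : ℕ → ℝ}

theorem IsCyclic.pos (h : IsCyclic n x) : 0 < n := by
  rcases Nat.eq_zero_or_pos n with rfl | hn
  · have := h.add_period 0
    simp at this
  · exact hn

theorem IsCyclic.add_mul (h : IsCyclic n x) (i k : ℕ) : x (i + n * k) = x i + k * (2 * π) := by
  induction k with
  | zero => simp
  | succ k ih => rw [mul_add, mul_one, ← add_assoc, h.add_period, ih]; push_cast; ring

theorem IsCyclic.circ_congr (h : IsCyclic n x) {i j : ℕ} (hij : i % n = j % n) :
    circ N (x i) = circ N (x j) := by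
  rw [← Nat.mod_add_div i n, ← Nat.mod_add_div j n, h.add_mul, h.add_mul, circ_add_nat_mul,
    circ_add_nat_mul, hij]

theorem IsCyclic.circ_mem (h : IsCyclic n x) (i : ℕ) : circ N (x i) ∈ cycFinset N n x :=
  Finset.mem_image.2 ⟨i % n, Finset.mem_range.2 (Nat.mod_lt _ h.pos),
    h.circ_congr (Nat.mod_mod _ _)⟩

theorem IsCyclic.exists_index (h : IsCyclic n x) {v : Plane} (hv : v ∈ cycFinset N n x) (i : ℕ) :
    ∃ j, i ≤ j ∧ j < i + n ∧ circ N (x j) = v := by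
  obtain ⟨k, hk, rfl⟩ := Finset.mem_image.1 hv
  have hn := h.pos
  refine ⟨i + (k + n * i - i) % n, by omega, by have := Nat.mod_lt (k + n * i - i) hn; omega,
    h.circ_congr ?_⟩
  have : i ≤ n * i := Nat.le_mul_of_pos_left i hn
  rw [Nat.add_mod_mod, show i + (k + n * i - i) = k + n * i by omega, Nat.add_mul_mod_self_left]

theorem IsCyclic.lt_add_two_pi (h : IsCyclic n x) {i j : ℕ} (hj : j < i + n) :
    x j < x i + 2 * π := by
  rw [← h.add_period]; exact h.strictMono hj

theorem IsCyclic.circ_ne (h : IsCyclic n x) (hN : ∀ x, N x = 0 → x = 0) {i j : ℕ} (hij : i < j)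
    (hj : j < i + n) : circ N (x i) ≠ circ N (x j) := fun e =>
  (h.strictMono hij).ne (eq_of_circ_eq hN (h.strictMono hij).le (h.lt_add_two_pi hj) e)

theorem IsCyclic.card (h : IsCyclic n x) (hN : ∀ x, N x = 0 → x = 0) :
    (cycFinset N n x).card = n := by
  rw [cycFinset, Finset.card_image_of_injOn, Finset.card_range]
  intro i hi j hj e
  simp only [Finset.coe_range, Set.mem_Iio] at hi hj
  rcases lt_trichotomy i j with hlt | rfl | hlt
  · exact absurd e (h.circ_ne hN hlt (by omega))
  · rfl
  · exact absurd e.symm (h.circ_ne hN hlt (by omega))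

theorem exists_isCyclic {F : Finset Plane} (hF : F.Nonempty)
    (hu : ∀ v ∈ F, N v = 1) : ∃ x, IsCyclic F.card x ∧ cycFinset N F.card x = F := by
  set S := F.image polarAngle with hS
  have hcirc : ∀ v ∈ F, circ N (polarAngle v) = v := fun v hv => circ_polarAngle (hu v hv)
  have hcard : S.card = F.card := by
    refine Finset.card_image_of_injOn fun v hv w hw e => ?_
    rw [← hcirc v hv, ← hcirc w hw, e]
  have hpos : 0 < F.card := hF.card_pos
  let y : ℕ → ℝ := fun i => if h : i < F.card then S.orderEmbOfFin hcard ⟨i, h⟩ else 0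
  have hy : ∀ i (h : i < F.card), y i = S.orderEmbOfFin hcard ⟨i, h⟩ := fun i h => dif_pos h
  have hyS : ∀ i, i < F.card → y i ∈ S := fun i h => by
    rw [hy i h]; exact Finset.orderEmbOfFin_mem _ _ _
  have hrange : ∀ s ∈ S, -π < s ∧ s ≤ π := by
    intro s hs
    obtain ⟨v, -, rfl⟩ := Finset.mem_image.1 hs
    exact ⟨Complex.neg_pi_lt_arg _, Complex.arg_le_pi _⟩
  refine ⟨wrap F.card (2 * π) y, ⟨strictMono_wrap (fun i hi => ?_) ?_ hpos, wrap_add hpos⟩, ?_⟩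
  · rw [hy i (by omega), hy (i + 1) hi]
    exact (S.orderEmbOfFin hcard).strictMono (by simp [Fin.lt_def])
  · have h1 := hrange _ (hyS (F.card - 1) (by omega))
    have h2 := hrange _ (hyS 0 hpos)
    linarith
  · ext v
    simp only [cycFinset, Finset.mem_image, Finset.mem_range]
    constructor
    · rintro ⟨i, hi, rfl⟩
      rw [wrap_of_lt hi]
      obtain ⟨v, hv, e⟩ := Finset.mem_image.1 (hyS i hi)
      rw [← e, hcirc v hv]; exact hv
    · intro hv
      have hmem : polarAngle v ∈ Set.range (S.orderEmbOfFin hcard) := by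
        rw [Finset.range_orderEmbOfFin]; exact Finset.mem_image_of_mem _ hv
      obtain ⟨⟨i, hi⟩, e⟩ := hmem
      exact ⟨i, hi, by rw [wrap_of_lt hi, hy i hi, e, hcirc v hv]⟩

theorem IsCyclic.isNext (h : IsCyclic n x) (hN : ∀ x, N x = 0 → x = 0) (hn : 2 ≤ n) (i : ℕ) :
    IsNext (cycFinset N n x) (circ N (x i)) (circ N (x (i + 1))) := by
  refine ⟨h.circ_mem i, h.circ_mem _, (h.circ_ne hN (Nat.lt_succ_self i) (by omega)).symm,
    fun u hu hne => ?_⟩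
  obtain ⟨j, hij, hj, rfl⟩ := h.exists_index hu i
  have hlt : i < j := lt_of_le_of_ne hij fun e => hne (by rw [e])
  have h1 := h.strictMono hlt
  have h2 := h.strictMono (Nat.lt_succ_self i)
  have h3 := h.strictMono.monotone (Nat.succ_le_of_lt hlt)
  rw [ccwAngle_circ hN h2.le (h.lt_add_two_pi (by omega)),
    ccwAngle_circ hN h1.le (h.lt_add_two_pi hj)]
  simp only [Nat.succ_eq_add_one] at h3 ⊢
  linarith

theorem IsCyclic.eq_of_isNext (h : IsCyclic n x) (hN : ∀ x, N x = 0 → x = 0) {i : ℕ}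
    {w : Plane} (hw : IsNext (cycFinset N n x) (circ N (x i)) w) : w = circ N (x (i + 1)) := by
  obtain ⟨-, hmem, hne, hmin⟩ := hw
  obtain ⟨j, hij, hj, rfl⟩ := h.exists_index hmem i
  have hlt : i < j := lt_of_le_of_ne hij fun e => hne (by rw [e])
  have h1 := h.strictMono hlt
  have h2 := h.strictMono (Nat.lt_succ_self i)
  have := hmin _ (h.circ_mem (i + 1)) (h.circ_ne hN (Nat.lt_succ_self i) (by omega)).symm
  rw [ccwAngle_circ hN h1.le (h.lt_add_two_pi hj),
    ccwAngle_circ hN h2.le (h.lt_add_two_pi (by omega))] at this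
  have hle : x j ≤ x (i + 1) := by linarith
  have := h.strictMono.le_iff_le.1 hle
  rw [show j = i + 1 by omega]

theorem IsCyclic.exists_index_of_cross_pos (h : IsCyclic n x) (hN : ∀ x, N x = 0 → x = 0) {i : ℕ}
    {w : Plane} (hw : w ∈ cycFinset N n x) (hc : 0 < cross (circ N (x i)) w) :
    ∃ j, i < j ∧ x j < x i + π ∧ circ N (x j) = w := by
  obtain ⟨j, hij, hj, rfl⟩ := h.exists_index hw i
  have h1 := h.strictMono.monotone hij
  have h2 := h.lt_add_two_pi hj
  rw [cross_circ_pos_iff hN] at hc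
  refine ⟨j, lt_of_le_of_ne hij ?_, ?_, rfl⟩
  · rintro rfl
    simp at hc
  · by_contra! hle
    have := sin_nonpos_of_nonpos_of_neg_pi_le (x := x j - x i - 2 * π) (by linarith)
      (by linarith)
    rw [sin_sub_two_pi] at this
    linarith

/-- If the origin were outside the hull, a linear functional would be positive on all of `F`, so `F`
would lie in an open half plane. Its counterclockwise-most member then has no successor. -/
theorem IsLinked.origin_mem {r : ℝ → Prop} {F : Finset Plane} (h : IsLinked N r F) :
    (0 : Plane) ∈ convexHull ℝ (F : Set Plane) := by
  by_contra hnot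
  obtain ⟨f, u, hu, hf⟩ := geometric_hahn_banach_point_closed (convex_convexHull ℝ (F : Set Plane))
    (F.finite_toSet.isClosed_convexHull ℝ) hnot
  rw [map_zero] at hu
  have hpos : ∀ v ∈ F, 0 < f v := fun v hv =>
    hu.trans (hf v (subset_convexHull ℝ _ hv))
  set a := f (EuclideanSpace.single 0 1) with ha
  set b := f (EuclideanSpace.single 1 1) with hb
  have hf' : ∀ v : Plane, f v = a * v 0 + b * v 1 := by
    intro v
    have : v = v 0 • EuclideanSpace.single 0 (1 : ℝ) + v 1 • EuclideanSpace.single 1 (1 : ℝ) := by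
      ext i; fin_cases i <;> simp
    conv_lhs => rw [this]
    rw [map_add, map_smul, map_smul, smul_eq_mul, smul_eq_mul]; ring
  -- The quotient is the tangent of the angle of `v` from the normal `(a, b)` of the half plane, so
  -- maximising it selects the counterclockwise-most member.
  obtain ⟨v, hv, hmax⟩ := F.exists_max_image (fun v => (a * v 1 - b * v 0) / f v) h.nonempty
  obtain ⟨w, hw, hcr, -⟩ := h.exists_succ v hv
  have h1 := hmax w hw
  have hv1 := hpos v hv
  have hw1 := hpos w hw
  rw [div_le_div_iff₀ hw1 hv1, hf' v, hf' w] at h1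
  have h2 : (a ^ 2 + b ^ 2) * cross v w ≤ 0 := by unfold cross; nlinarith
  rw [hf' v] at hv1
  have h3 : 0 < a ^ 2 + b ^ 2 := by
    by_contra! h3
    have ha0 : a = 0 := by nlinarith [sq_nonneg a, sq_nonneg b]
    have hb0 : b = 0 := by nlinarith [sq_nonneg a, sq_nonneg b]
    rw [ha0, hb0] at hv1
    simp at hv1
  nlinarith

/-- All vectors lie in an arc shorter than a half turn, hence in the open half plane around its
bisector `m`. -/
theorem IsCyclic.origin_notMem (h : IsCyclic n x) (hN : ∀ x, N x = 0 → x = 0) {i : ℕ}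
    (hgap : x i + π < x (i + 1)) :
    (0 : Plane) ∉ convexHull ℝ (cycFinset N n x : Set Plane) := by
  set m := (x (i + 1) + x (i + n)) / 2 with hm
  let H : Set Plane := {v | 0 < v 0 * cos m + v 1 * sin m}
  have hH : Convex ℝ H := by
    refine convex_halfSpace_gt (f := fun v : Plane => v 0 * cos m + v 1 * sin m) ⟨?_, ?_⟩ 0
    · intro v w; simp; ring
    · intro c v; simp; ring
  have hsub : (cycFinset N n x : Set Plane) ⊆ H := by
    intro v hv
    obtain ⟨j, hij, hj, rfl⟩ := h.exists_index hv (i + 1)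
    have h1 := h.strictMono.monotone hij
    have h2 := h.strictMono.monotone (show j ≤ i + n by omega)
    have h3 := h.add_period i
    have hp := inv_pos.2 (seminorm_dir_pos hN (x j))
    have hcos : 0 < cos (x j - m) :=
      cos_pos_of_mem_Ioo ⟨by linarith, by linarith⟩
    have e : circ N (x j) 0 * cos m + circ N (x j) 1 * sin m =
        (N (dir (x j)))⁻¹ * cos (x j - m) := by
      rw [cos_sub]; simp [circ]; ring
    change 0 < circ N (x j) 0 * cos m + circ N (x j) 1 * sin m
    rw [e]; positivity
  intro h0
  have := convexHull_min hsub hH h0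
  simp [H] at this

/-- A family has no gap of more than a half turn because of the origin, and none of exactly a half
turn because antipodal unit vectors are at distance 2, which `r` excludes. Conversely, the immediate
successor is no farther than any other vector in the next half turn. Unlike consecutiveness, being
linked refers to no cyclic order, which makes it easy to pass to subsets. -/
theorem isFamily_iff_isLinked (hN : ∀ x, N x = 0 → x = 0) {r : ℝ → Prop}
    (hr : ∀ a b, a ≤ b → r b → r a) (hr2 : ¬ r 2) {F : Finset Plane} :
    IsFamily N r F ↔ IsLinked N r F := by
  constructor
  · intro h
    have hne : F.Nonempty := by
      rcases F.eq_empty_or_nonempty with rfl | hne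
      · simpa using h.origin_mem
      · exact hne
    obtain ⟨x, hx, e⟩ := exists_isCyclic hne h.unit
    have hn : 2 ≤ F.card := by
      by_contra! hlt
      obtain ⟨v, rfl⟩ := Finset.card_eq_one.1 (show F.card = 1 by have := hne.card_pos; omega)
      have h0 := h.origin_mem
      have h1 := h.unit v (by simp)
      simp only [Finset.coe_singleton, convexHull_singleton, Set.mem_singleton_iff] at h0
      rw [← h0, map_zero] at h1
      exact zero_ne_one h1
    refine ⟨hne, h.unit, fun v hv => ?_⟩
    rw [← e] at hv
    obtain ⟨i, -, -, rfl⟩ := hx.exists_index hv 0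
    have hnext := hx.isNext hN hn i
    have h1 := hx.strictMono (Nat.lt_succ_self i)
    rw [e] at hnext
    have hclose := h.consecutive _ _ hnext
    refine ⟨_, hnext.2.1, cross_circ_pos hN h1 ?_, hclose⟩
    rcases lt_trichotomy (x (i + 1)) (x i + π) with hlt | heq | hgt
    · exact hlt
    · refine absurd hclose ?_
      rw [heq]
      change ¬ r (cdist N (x i) (x i + π))
      rwa [cdist_self_add_pi hN]
    · have h0 := hx.origin_notMem hN hgt
      rw [e] at h0
      exact absurd h.origin_mem h0
  · intro h
    refine ⟨h.unit, fun v w hvw => ?_, h.origin_mem⟩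
    obtain ⟨x, hx, e⟩ := exists_isCyclic h.nonempty h.unit
    have hv := hvw.1
    obtain ⟨w', hw', hcr, hr'⟩ := h.exists_succ v hv
    rw [← e] at hvw hv hw'
    obtain ⟨i, -, -, rfl⟩ := hx.exists_index hv 0
    obtain ⟨j, hij, hj, rfl⟩ := hx.exists_index_of_cross_pos hN hw' hcr
    rw [hx.eq_of_isNext hN hvw]
    exact hr _ _ (cdist_mono_right hN (hx.strictMono (Nat.lt_succ_self i)).le
      (hx.strictMono.monotone hij) hj.le) hr'

/-- Consecutive angles are `r`-close, but angles two apart are not. -/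
structure IsTightCycle (N : Seminorm ℝ Plane) (r : ℝ → Prop) (n : ℕ) (x : ℕ → ℝ) : Prop
    extends IsCyclic n x where
  gap_lt : ∀ i, x (i + 1) < x i + π
  close : ∀ i, r (cdist N (x i) (x (i + 1)))
  far : ∀ i, x (i + 2) < x i + π → ¬ r (cdist N (x i) (x (i + 2)))

/-- In a linked subset, the close successor of a member must be its immediate neighbour in the
cycle, since by monotonicity everything farther is as bad as the vector two places on. So the subset
contains, with one member, the whole cycle. -/
theorem IsTightCycle.minimal (hN : ∀ x, N x = 0 → x = 0) {r : ℝ → Prop}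
    (hr : ∀ a b, a ≤ b → r b → r a) (h : IsTightCycle N r n x) :
    Minimal (IsLinked N r) (cycFinset N n x) := by
  have hx := h.toIsCyclic
  refine ⟨⟨⟨_, hx.circ_mem 0⟩, fun v hv => ?_, fun v hv => ?_⟩, fun G hG hGF => ?_⟩
  · obtain ⟨i, -, -, rfl⟩ := hx.exists_index hv 0
    exact seminorm_circ hN _
  · obtain ⟨i, -, -, rfl⟩ := hx.exists_index hv 0
    exact ⟨_, hx.circ_mem (i + 1), cross_circ_pos hN (hx.strictMono (Nat.lt_succ_self i))
      (h.gap_lt i), h.close i⟩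
  · obtain ⟨v, hv⟩ := hG.nonempty
    obtain ⟨i, -, -, rfl⟩ := hx.exists_index (hGF hv) 0
    have hstep : ∀ j, i ≤ j → circ N (x j) ∈ G := by
      intro j hj
      induction j, hj using Nat.le_induction with
      | base => exact hv
      | succ j _ ih =>
        obtain ⟨w, hw, hcr, hrw⟩ := hG.exists_succ _ ih
        obtain ⟨k, hjk, hk, rfl⟩ := hx.exists_index_of_cross_pos hN (hGF hw) hcr
        rcases (Nat.succ_le_of_lt hjk).eq_or_lt with rfl | hlt
        · exact hw
        · have hle := hx.strictMono.monotone (Nat.succ_le_of_lt hlt)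
          exact absurd (hr _ _ (cdist_mono_right hN (hx.strictMono.monotone (by omega)) hle hk.le)
            hrw) (h.far j (lt_of_le_of_lt hle hk))
    intro w hw
    obtain ⟨j, hij, -, rfl⟩ := hx.exists_index hw i
    exact hstep j hij

/-- If two members two places apart were close within a half turn, the one between them could be
erased and the set would remain linked. -/
theorem exists_isTightCycle (hN : ∀ x, N x = 0 → x = 0) {r : ℝ → Prop}
    (hr : ∀ a b, a ≤ b → r b → r a) {F : Finset Plane} (hF : Minimal (IsLinked N r) F) :
    ∃ x, IsTightCycle N r F.card x := by
  have hL := hF.prop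
  obtain ⟨x, hx, e⟩ := exists_isCyclic hL.nonempty hL.unit
  have hsucc : ∀ i, x (i + 1) < x i + π ∧ r (cdist N (x i) (x (i + 1))) := by
    intro i
    obtain ⟨w, hw, hcr, hrw⟩ := hL.exists_succ (circ N (x i)) (by
      have := hx.circ_mem (N := N) i
      rwa [e] at this)
    rw [← e] at hw
    obtain ⟨j, hij, hj, rfl⟩ := hx.exists_index_of_cross_pos hN hw hcr
    have hle := hx.strictMono.monotone (Nat.succ_le_of_lt hij)
    exact ⟨lt_of_le_of_lt hle hj, hr _ _ (cdist_mono_right hN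
      (hx.strictMono (Nat.lt_succ_self i)).le hle hj.le) hrw⟩
  refine ⟨x, hx, fun i => (hsucc i).1, fun i => (hsucc i).2, fun i hgap hclose => ?_⟩
  have hn : 2 ≤ F.card := by
    by_contra! hlt
    have h1 : F.card = 1 := by have := hx.pos; omega
    have h2 := hx.add_period i
    rw [h1] at h2
    have := (hsucc i).1
    linarith [pi_pos]
  have hmem : ∀ j, circ N (x j) ∈ F := fun j => by
    have := hx.circ_mem (N := N) j
    rwa [e] at this
  have hG : IsLinked N r (F.erase (circ N (x (i + 1)))) := by
    refine ⟨⟨circ N (x (i + 2)), Finset.mem_erase.2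
      ⟨(hx.circ_ne hN (by omega) (by omega)).symm, hmem _⟩⟩,
      fun v hv => hL.unit v (Finset.mem_of_mem_erase hv), fun v hv => ?_⟩
    obtain ⟨hne, hv⟩ := Finset.mem_erase.1 hv
    rw [← e] at hv
    obtain ⟨j, hij, hj, rfl⟩ := hx.exists_index hv (i + 1)
    have hlt : i + 1 < j := lt_of_le_of_ne hij fun h => hne (by rw [h])
    rcases (show j ≤ i + F.card by omega).eq_or_lt with rfl | hj'
    · rw [hx.circ_congr (Nat.add_mod_right i F.card)]
      exact ⟨circ N (x (i + 2)), Finset.mem_erase.2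
        ⟨(hx.circ_ne hN (by omega) (by omega)).symm, hmem _⟩,
        cross_circ_pos hN (hx.strictMono (by omega)) hgap, hclose⟩
    · exact ⟨circ N (x (j + 1)), Finset.mem_erase.2
        ⟨(hx.circ_ne hN (by omega) (by omega)).symm, hmem _⟩,
        cross_circ_pos hN (hx.strictMono (Nat.lt_succ_self j)) (hsucc j).1, (hsucc j).2⟩
  exact Finset.notMem_erase _ _ (hF.le_of_le hG (Finset.erase_subset _ _) (hmem (i + 1)))

end

section

open Real

variable {N : Seminorm ℝ Plane} {n : ℕ} {x : ℕ → ℝ}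

/-! ### Tight hexagons in terms of angles -/

/-- The angles of the vertices of a tight hexagon, continued periodically. -/
structure IsHexAngles (N : Seminorm ℝ Plane) (t : ℕ → ℝ) : Prop where
  add_three : ∀ j, t (j + 3) = t j + π
  lt_succ : ∀ j, t j < t (j + 1)
  cdist_succ : ∀ j, cdist N (t j) (t (j + 1)) = 1
  inner : ∀ j β, t j < β → β ≤ t (j + 1) → cdist N β (t (j + 1)) < 1
  outer : ∀ j β, t (j + 1) < β → β ≤ t j + π → 1 < cdist N (t j) β

/-- Along a half circle the distance from a fixed unit vector runs continuously from 0 to 2, so it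
takes the value 1. -/
theorem exists_hexagon (hN : ∀ x, N x = 0 → x = 0) (hc : Continuous N) :
    ∃ h0 h1, 0 < cross h0 h1 ∧ N h0 = 1 ∧ N h1 = 1 ∧ N (h1 - h0) = 1 := by
  have h1 : (1 : ℝ) ∈ Set.Icc (cdist N 0 0) (cdist N 0 (0 + π)) := by
    rw [cdist_self, cdist_self_add_pi hN]; norm_num
  obtain ⟨θ, ⟨h2, h3⟩, h4⟩ := intermediate_value_Icc (by linarith [pi_pos])
    (continuous_cdist_right hN hc 0).continuousOn h1
  refine ⟨circ N 0, circ N θ, cross_circ_pos hN (lt_of_le_of_ne h2 ?_) (lt_of_le_of_ne h3 ?_),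
    seminorm_circ hN _, seminorm_circ hN _, ?_⟩
  · rintro rfl
    simp [cdist_self] at h4
  · rintro rfl
    simp only [cdist_self_add_pi hN] at h4
    norm_num at h4
  · rw [map_sub_rev]; exact h4

/-- With consecutive vertices `H j`, one has `H (j + 2) = H (j + 1) - H j` and `H (j + 3) = -H j`,
so the three edge conditions become a single one, valid at every index. The two hexagon lemmas then
give `inner` and `outer`. -/
theorem IsTightHexagon.exists_isHexAngles (hN : ∀ x, N x = 0 → x = 0) {h0 h1 : Plane}
    (h : IsTightHexagon N h0 h1) : ∃ t, IsHexAngles N t := by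
  set T0 := polarAngle h0
  have c0 : circ N T0 = h0 := circ_polarAngle h.norm_zero
  obtain ⟨T1, hT1, hT1', c1⟩ := exists_circ_eq_of_cross_pos hN (α := T0) h.norm_one
    (by rw [c0]; exact h.cross_pos)
  obtain ⟨T2, hT2, hT2', c2⟩ := exists_circ_eq_of_cross_pos hN (α := T1) h.norm_sub
    (by
      rw [c1, show cross h1 (h1 - h0) = cross h0 h1 by simp [cross]; ring]
      exact h.cross_pos)
  have hT3 : T2 < T0 + π := by
    refine lt_of_cross_circ_pos hN (by linarith) ?_
    rw [c2, circ_add_pi, c0, show cross (h1 - h0) (-h0) = cross h0 h1 by simp [cross]; ring]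
    exact h.cross_pos
  set t := wrap 3 π fun i => if i = 0 then T0 else if i = 1 then T1 else T2 with ht
  have ht3 : ∀ j, t (j + 3) = t j + π := wrap_add (by norm_num)
  have hH3 : ∀ j, circ N (t (j + 3)) = -circ N (t j) := fun j => by rw [ht3, circ_add_pi]
  have t0 : t 0 = T0 := wrap_of_lt (by norm_num)
  have t1 : t 1 = T1 := wrap_of_lt (by norm_num)
  have t2 : t 2 = T2 := wrap_of_lt (by norm_num)
  have t3 : t 3 = T0 + π := by rw [ht3 0, t0]
  have t4 : t 4 = T1 + π := by rw [ht3 1, t1]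
  have key : ∀ j, t j < t (j + 1) ∧ circ N (t (j + 2)) = circ N (t (j + 1)) - circ N (t j) ∧
      ∀ l : ℝ, 0 < l → 1 < N (circ N (t (j + 2)) - l • circ N (t j)) := by
    refine forall_of_periodic (m := 3) ?_ ?_ (by norm_num)
    · intro j hj
      interval_cases j
      · refine ⟨by rw [t0, t1]; exact hT1, by rw [t0, t1, t2, c0, c1, c2], fun l hl => ?_⟩
        rw [t0, t2, c0, c2]
        exact h.edge_zero l hl
      · refine ⟨by rw [t1, t2]; exact hT2, ?_, fun l hl => ?_⟩
        · rw [t1, t2, t3, circ_add_pi, c0, c1, c2]; module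
        · rw [t1, t3, circ_add_pi, c0, c1, show -h0 - l • h1 = -(h0 + l • h1) by module,
            map_neg_eq_map]
          exact h.edge_one l hl
      · refine ⟨by rw [t2, t3]; exact hT3, ?_, fun l hl => ?_⟩
        · rw [t2, t3, t4, circ_add_pi, circ_add_pi, c0, c1, c2]; module
        · rw [t2, t4, circ_add_pi, c1, c2,
            show -h1 - l • (h1 - h0) = -(h1 + l • (h1 - h0)) by module, map_neg_eq_map]
          exact h.edge_two l hl
    · rintro j ⟨h1, h2, h3⟩
      refine ⟨?_, ?_, fun l hl => ?_⟩
      · rw [show j + 3 + 1 = j + 1 + 3 by ring, ht3, ht3]; linarith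
      · rw [show j + 3 + 1 = j + 1 + 3 by ring, show j + 3 + 2 = j + 2 + 3 by ring, hH3, hH3, hH3,
          h2]
        module
      · rw [show j + 3 + 2 = j + 2 + 3 by ring, hH3, hH3]
        rw [show -circ N (t (j + 2)) - l • -circ N (t j) =
          -(circ N (t (j + 2)) - l • circ N (t j)) by module, map_neg_eq_map]
        exact h3 l hl
  have hlt : ∀ j, t j < t (j + 1) := fun j => (key j).1
  have n1 : ∀ j, N (circ N (t (j + 1)) - circ N (t j)) = 1 := fun j => by
    rw [← (key j).2.1, seminorm_circ hN]
  have hpi : ∀ j, t (j + 1) < t j + π := fun j => by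
    rw [← ht3]; exact (hlt (j + 1)).trans (hlt (j + 2))
  refine ⟨t, ht3, hlt, fun j => ?_, fun j β h1 h2 => ?_, fun j β h1 h2 => ?_⟩
  · rw [cdist_comm]; exact n1 j
  · obtain ⟨a, b, ha, hb, hb', -, e⟩ := exists_cone hN (N := N) h1.le h2 (hlt j) (hpi j)
    refine seminorm_sub_lt_one_of_hexagon N (seminorm_circ hN _) (seminorm_circ hN _) (n1 j)
      (fun l hl => ?_) ha (hb' h1) e (seminorm_circ hN _)
    have := (key (j + 1)).2.2 l hl
    rwa [show j + 1 + 2 = j + 3 by ring, hH3, show -circ N (t j) - l • circ N (t (j + 1)) =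
      -(circ N (t j) + l • circ N (t (j + 1))) by module, map_neg_eq_map] at this
  · set γ := min β (t (j + 2)) with hγ
    have hγ1 : t (j + 1) < γ := lt_min h1 (hlt (j + 1))
    refine lt_of_lt_of_le ?_ (cdist_mono_right hN ((hlt j).trans hγ1).le (min_le_left _ _) h2)
    obtain ⟨a, b, ha, hb, hb', -, e⟩ := exists_cone hN (N := N) hγ1.le (min_le_right β (t (j + 2)))
      (hlt (j + 1)) (hpi (j + 1))
    rw [show j + 1 + 1 = j + 2 by ring, (key j).2.1] at e
    rw [cdist_comm]
    refine one_lt_seminorm_sub_of_hexagon N (seminorm_circ hN _) (seminorm_circ hN _) (n1 j)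
      (fun l hl => ?_) ha (hb' hγ1) e (seminorm_circ hN _)
    rw [← (key j).2.1]
    exact (key j).2.2 l hl

theorem exists_isHexAngles (hN : ∀ x, N x = 0 → x = 0) (hc : Continuous N)
    (hmax : ¬ ∃ d f, IsMaxNorm N d f) : ∃ t, IsHexAngles N t := by
  obtain ⟨h0, h1, hh, n0, n1, n2⟩ := exists_hexagon hN hc
  obtain ⟨k0, k1, h⟩ := exists_isTightHexagon_of_hexagon hc hmax hh n0 n1 n2
  exact h.exists_isHexAngles hN

/-! ### Upper bounds -/

theorem IsTightCycle.le_eleven (hN : ∀ x, N x = 0 → x = 0)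
    (h : IsTightCycle N (· ≤ 1) n x) : n ≤ 11 := by
  have hstep : ∀ i, x i + π < x (i + 6) := fun i =>
    add_pi_lt_of_three_far hN (h.strictMono (show i < i + 2 by omega))
      (h.strictMono (show i + 2 < i + 4 by omega)) (h.strictMono (show i + 4 < i + 6 by omega))
      (fun hlt => not_le.1 (h.far i hlt)) (fun hlt => not_le.1 (h.far (i + 2) hlt))
      (fun hlt => not_le.1 (h.far (i + 4) hlt))
  have h1 := hstep 0
  have h2 := hstep 6
  have h3 := h.add_period 0
  have : x (0 + n) < x 12 := by rw [h3]; norm_num at h1 h2; linarith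
  have := h.strictMono.lt_iff_lt.1 this
  omega

/-- Each passage of a mark `τ k` to the next uses up at most `q` members, and there are `p` marks
per turn. -/
theorem IsCyclic.le_mul (h : IsCyclic n x) {τ : ℕ → ℝ} {p q : ℕ}
    (hτ : ∀ j, τ (j + p) = τ j + 2 * π) (hstep : ∀ i k, τ k < x i → τ (k + 1) < x (i + q)) :
    n ≤ p * q := by
  have hτm : ∀ m : ℕ, τ (p * m) = τ 0 + m * (2 * π) := by
    intro m
    induction m with
    | zero => simp
    | succ m ih => rw [mul_add, mul_one, hτ, ih]; push_cast; ring
  obtain ⟨m, hm⟩ := exists_nat_gt ((x 0 - τ 0) / (2 * π))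
  rw [div_lt_iff₀ two_pi_pos] at hm
  obtain ⟨m', hm'⟩ := exists_nat_gt ((τ (p * m) - x 0) / (2 * π))
  rw [div_lt_iff₀ two_pi_pos] at hm'
  -- Counting starts at the first member beyond a mark that lies after `x 0`. Its predecessor is not
  -- beyond that mark, and comparing with the predecessor after a full turn gives `n ≤ p * q`
  -- without loss.
  have hex : ∃ i, τ (p * m) < x i := ⟨0 + n * m', by rw [h.add_mul]; linarith⟩
  set i := Nat.find hex with hi
  have hi1 : τ (p * m) < x i := Nat.find_spec hex
  have hi0 : i ≠ 0 := by
    intro h0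
    rw [h0, hτm] at hi1
    linarith
  have hi2 : x (i - 1) ≤ τ (p * m) := not_lt.1 (Nat.find_min hex (by omega))
  have hk : ∀ k, τ (p * m + k) < x (i + q * k) := by
    intro k
    induction k with
    | zero => exact hi1
    | succ k ih => rw [mul_add, mul_one, ← add_assoc, ← add_assoc]; exact hstep _ _ ih
  have h1 := hk p
  rw [hτ] at h1
  have h2 := h.add_period (i - 1)
  have : x (i - 1 + n) < x (i + q * p) := by linarith
  have := h.strictMono.lt_iff_lt.1 this
  rw [mul_comm p q]
  omega

/-- If `x i` and `x (i + 2)` were in one arc, open at its start and closed at its end, they would be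
closer than one by `inner`. -/
theorem IsTightCycle.le_twelve_of_isHexAngles (hN : ∀ x, N x = 0 → x = 0) {t : ℕ → ℝ}
    (ht : IsHexAngles N t) (h : IsTightCycle N (· < 1) n x) : n ≤ 12 := by
  refine h.toIsCyclic.le_mul (τ := t) (p := 6) (q := 2) (fun j => ?_) fun i k hk => ?_
  · rw [show j + 6 = j + 3 + 3 by ring, ht.add_three, ht.add_three]; ring
  · by_contra! hle
    have h1 := h.strictMono (show i < i + 2 by omega)
    have h2 : t (k + 1) < t k + π := by
      rw [← ht.add_three]; exact (ht.lt_succ _).trans (ht.lt_succ _)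
    refine h.far i (by linarith) ?_
    exact (cdist_mono_right hN h1.le hle (by linarith)).trans_lt (ht.inner k _ hk (h1.le.trans hle))

/-- The angles of the vectors `±d, ±f` for a maximum norm, continued periodically. -/
structure IsQuadAngles (N : Seminorm ℝ Plane) (τ : ℕ → ℝ) : Prop where
  add_two : ∀ j, τ (j + 2) = τ j + π
  lt_succ : ∀ j, τ j < τ (j + 1)
  eq_max : ∀ j, ∀ a b : ℝ, N (a • circ N (τ j) + b • circ N (τ (j + 1))) = max |a| |b|

theorem IsMaxNorm.exists_isQuadAngles (hN : ∀ x, N x = 0 → x = 0) {d f : Plane}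
    (h : IsMaxNorm N d f) : ∃ τ, IsQuadAngles N τ := by
  have nd : N d = 1 := by simpa using h.eq_max 1 0
  have nf : N f = 1 := by simpa using h.eq_max 0 1
  have c0 : circ N (polarAngle d) = d := circ_polarAngle nd
  set T0 := polarAngle d
  obtain ⟨T1, hT1, hT1', c1⟩ := exists_circ_eq_of_cross_pos hN (α := T0) nf
    (by rw [c0]; exact h.cross_pos)
  set τ := wrap 2 π fun i => if i = 0 then T0 else T1 with hτ
  have ht2 : ∀ j, τ (j + 2) = τ j + π := wrap_add (by norm_num)
  have t0 : τ 0 = T0 := wrap_of_lt (by norm_num)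
  have t1 : τ 1 = T1 := wrap_of_lt (by norm_num)
  have t2 : τ 2 = T0 + π := by rw [ht2 0, t0]
  have key : ∀ j, τ j < τ (j + 1) ∧
      ∀ a b : ℝ, N (a • circ N (τ j) + b • circ N (τ (j + 1))) = max |a| |b| := by
    refine forall_of_periodic (m := 2) ?_ ?_ (by norm_num)
    · intro j hj
      interval_cases j
      · exact ⟨by rw [t0, t1]; exact hT1, by rw [t0, t1, c0, c1]; exact h.eq_max⟩
      · refine ⟨by rw [t1, t2]; exact hT1', fun a b => ?_⟩
        rw [t1, t2, circ_add_pi, c0, c1, show a • f + b • -d = (-b) • d + a • f by module,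
          h.eq_max, abs_neg, max_comm]
    · rintro j ⟨h1, h2⟩
      rw [show j + 2 + 1 = j + 1 + 2 by ring, ht2, ht2, circ_add_pi, circ_add_pi]
      refine ⟨by linarith, fun a b => ?_⟩
      rw [show a • -circ N (τ j) + b • -circ N (τ (j + 1)) =
        -(a • circ N (τ j) + b • circ N (τ (j + 1))) by module, map_neg_eq_map, h2]
  exact ⟨τ, ht2, fun j => (key j).1, fun j => (key j).2⟩

theorem IsQuadAngles.succ_lt {τ : ℕ → ℝ} (h : IsQuadAngles N τ) (j : ℕ) :
    τ (j + 1) < τ j + π := by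
  rw [← h.add_two]; exact h.lt_succ _

theorem IsQuadAngles.cdist_le_one (hN : ∀ x, N x = 0 → x = 0) {τ : ℕ → ℝ}
    (h : IsQuadAngles N τ) {j : ℕ} {β γ : ℝ} (h1 : τ j ≤ β) (h2 : β ≤ τ (j + 1)) (h3 : τ j ≤ γ)
    (h4 : γ ≤ τ (j + 1)) : cdist N β γ ≤ 1 := by
  obtain ⟨a, b, ha, hb, -, -, e⟩ := exists_cone hN (N := N) h1 h2 (h.lt_succ j) (h.succ_lt j)
  obtain ⟨a', b', ha', hb', -, -, e'⟩ :=
    exists_cone hN (N := N) h3 h4 (h.lt_succ j) (h.succ_lt j)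
  have m := h.eq_max j a b
  have m' := h.eq_max j a' b'
  rw [← e, seminorm_circ hN, abs_of_nonneg ha, abs_of_nonneg hb] at m
  rw [← e', seminorm_circ hN, abs_of_nonneg ha', abs_of_nonneg hb'] at m'
  have := le_max_left a b
  have := le_max_right a b
  have := le_max_left a' b'
  have := le_max_right a' b'
  rw [cdist, e, e', show a • circ N (τ j) + b • circ N (τ (j + 1)) -
    (a' • circ N (τ j) + b' • circ N (τ (j + 1))) =
    (a - a') • circ N (τ j) + (b - b') • circ N (τ (j + 1)) by module, h.eq_max]
  exact max_le (abs_le.2 ⟨by linarith, by linarith⟩) (abs_le.2 ⟨by linarith, by linarith⟩)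

theorem IsQuadAngles.cdist_lt_one (hN : ∀ x, N x = 0 → x = 0) {τ : ℕ → ℝ}
    (h : IsQuadAngles N τ) {j : ℕ} {β γ : ℝ} (h1 : τ j < β) (h2 : β < τ (j + 1)) (h3 : τ j < γ)
    (h4 : γ < τ (j + 1)) : cdist N β γ < 1 := by
  obtain ⟨a, b, -, -, hb, ha, e⟩ :=
    exists_cone hN (N := N) h1.le h2.le (h.lt_succ j) (h.succ_lt j)
  obtain ⟨a', b', -, -, hb', ha', e'⟩ :=
    exists_cone hN (N := N) h3.le h4.le (h.lt_succ j) (h.succ_lt j)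
  replace ha := ha h2
  replace hb := hb h1
  replace ha' := ha' h4
  replace hb' := hb' h3
  have m := h.eq_max j a b
  have m' := h.eq_max j a' b'
  rw [← e, seminorm_circ hN, abs_of_pos ha, abs_of_pos hb] at m
  rw [← e', seminorm_circ hN, abs_of_pos ha', abs_of_pos hb'] at m'
  have := le_max_left a b
  have := le_max_right a b
  have := le_max_left a' b'
  have := le_max_right a' b'
  rw [cdist, e, e', show a • circ N (τ j) + b • circ N (τ (j + 1)) -
    (a' • circ N (τ j) + b' • circ N (τ (j + 1))) =
    (a - a') • circ N (τ j) + (b - b') • circ N (τ (j + 1)) by module, h.eq_max]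
  exact max_lt (abs_lt.2 ⟨by linarith, by linarith⟩) (abs_lt.2 ⟨by linarith, by linarith⟩)

theorem IsQuadAngles.add_four {τ : ℕ → ℝ} (h : IsQuadAngles N τ) (j : ℕ) :
    τ (j + 4) = τ j + 2 * π := by
  rw [show j + 4 = j + 2 + 2 by ring, h.add_two, h.add_two]; ring

theorem IsTightCycle.le_eight_of_isQuadAngles (hN : ∀ x, N x = 0 → x = 0) {τ : ℕ → ℝ}
    (ht : IsQuadAngles N τ) (h : IsTightCycle N (· ≤ 1) n x) : n ≤ 8 := by
  refine h.toIsCyclic.le_mul (p := 4) (q := 2) ht.add_four fun i k hk => ?_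
  by_contra! hle
  have h1 := h.strictMono (show i < i + 2 by omega)
  have h2 := ht.succ_lt k
  exact h.far i (by linarith) (ht.cdist_le_one hN hk.le (by linarith) (by linarith) hle)

/-- Only two points of an open side are sure to be closer than one. If `x (i + 3)` is still on the
side, possibly at its end, then `x (i + 2)` is in the open side; hence three members per side
instead of two. -/
theorem IsTightCycle.le_twelve_of_isQuadAngles (hN : ∀ x, N x = 0 → x = 0) {τ : ℕ → ℝ}
    (ht : IsQuadAngles N τ) (h : IsTightCycle N (· < 1) n x) : n ≤ 12 := by
  refine h.toIsCyclic.le_mul (p := 4) (q := 3) ht.add_four fun i k hk => ?_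
  by_contra! hle
  have h1 := h.strictMono (show i < i + 2 by omega)
  have h3 := h.strictMono (show i + 2 < i + 3 by omega)
  have h2 := ht.succ_lt k
  exact h.far i (by linarith)
    (ht.cdist_lt_one hN hk (by linarith) (by linarith) (by linarith))

end

section

open Real

variable {N : Seminorm ℝ Plane} {r : ℝ → Prop}

/-! ### Constructions -/

theorem exists_periodic_extension {m : ℕ} {c : ℝ} (hm : 2 ≤ m)
    (hc : ∀ α β, cdist N (α + c) (β + c) = cdist N α β) {y : ℕ → ℝ}
    (hy : ∀ i < m, y i < y (i + 1)) (h0 : y m = y 0 + c) (h1 : y (m + 1) = y 1 + c)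
    (close : ∀ i < m, r (cdist N (y i) (y (i + 1))))
    (far : ∀ i < m, ¬ r (cdist N (y i) (y (i + 2)))) :
    ∃ x : ℕ → ℝ, StrictMono x ∧ (∀ i, x (i + m) = x i + c) ∧ (∀ i < m + 2, x i = y i) ∧
      (∀ i, r (cdist N (x i) (x (i + 1)))) ∧ ∀ i, ¬ r (cdist N (x i) (x (i + 2))) := by
  have hm0 : 0 < m := by omega
  have hp : ∀ i, wrap m c y (i + m) = wrap m c y i + c := wrap_add hm0
  have hxy : ∀ i < m + 2, wrap m c y i = y i := by
    intro i hi
    rcases lt_or_ge i m with h | h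
    · exact wrap_of_lt h
    · obtain rfl | rfl : i = 0 + m ∨ i = 1 + m := by omega
      · rw [hp, wrap_of_lt hm0, zero_add, h0]
      · rw [hp, wrap_of_lt (by omega), add_comm 1 m, h1]
  refine ⟨wrap m c y, strictMono_wrap (fun i hi => hy i (by omega)) ?_ hm0, hp, hxy, ?_, ?_⟩
  · rw [← h0]
    have := hy (m - 1) (by omega)
    rwa [Nat.sub_add_cancel hm0] at this
  · refine forall_of_periodic (m := m) (fun i hi => ?_) (fun i h => ?_) hm0
    · rw [hxy i (by omega), hxy (i + 1) (by omega)]; exact close i hi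
    · rwa [show i + m + 1 = i + 1 + m by ring, hp, hp, hc]
  · refine forall_of_periodic (m := m) (fun i hi => ?_) (fun i h => ?_) hm0
    · rw [hxy i (by omega), hxy (i + 2) (by omega)]; exact far i hi
    · rwa [show i + m + 2 = i + 2 + m by ring, hp, hp, hc]

theorem exists_isTightCycle_of_full_turn {m : ℕ} (hm : 2 ≤ m) {y : ℕ → ℝ}
    (hy : ∀ i < m, y i < y (i + 1)) (hgap : ∀ i < m, y (i + 1) < y i + π)
    (h0 : y m = y 0 + 2 * π) (h1 : y (m + 1) = y 1 + 2 * π)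
    (close : ∀ i < m, r (cdist N (y i) (y (i + 1))))
    (far : ∀ i < m, ¬ r (cdist N (y i) (y (i + 2)))) : ∃ x, IsTightCycle N r m x := by
  obtain ⟨x, hx, hp, hxy, hcl, hfar⟩ :=
    exists_periodic_extension hm cdist_add_two_pi hy h0 h1 close far
  refine ⟨x, ⟨hx, hp⟩, ?_, hcl, fun i _ => hfar i⟩
  refine forall_of_periodic (m := m) (fun i hi => ?_) (fun i h => ?_) (by omega)
  · rw [hxy i (by omega), hxy (i + 1) (by omega)]; exact hgap i hi
  · rw [show i + m + 1 = i + 1 + m by ring, hp, hp]; linarith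

theorem exists_isTightCycle_of_half_turn {m : ℕ} (hm : 2 ≤ m) {y : ℕ → ℝ}
    (hy : ∀ i < m, y i < y (i + 1)) (h0 : y m = y 0 + π) (h1 : y (m + 1) = y 1 + π)
    (close : ∀ i < m, r (cdist N (y i) (y (i + 1))))
    (far : ∀ i < m, ¬ r (cdist N (y i) (y (i + 2)))) : ∃ x, IsTightCycle N r (m + m) x := by
  obtain ⟨x, hx, hp, hxy, hcl, hfar⟩ :=
    exists_periodic_extension hm cdist_add_pi hy h0 h1 close far
  refine ⟨x, ⟨hx, fun i => ?_⟩, fun i => ?_, hcl, fun i _ => hfar i⟩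
  · rw [← add_assoc, hp, hp]; ring
  · rw [← hp]; exact hx (by omega)

/-- The vertex `t j` itself is at distance more than one from `b` and less than one from `p`; by
continuity so are the points just after it. -/
theorem IsHexAngles.exists_near (hN : ∀ x, N x = 0 → x = 0) (hc : Continuous N) {t : ℕ → ℝ}
    (ht : IsHexAngles N t) {j : ℕ} {p b u : ℝ} (hp : cdist N p (t j) < 1) (hb : t (j + 1) < b)
    (hb' : b ≤ t j + π) (hu : t j < u) :
    ∃ a, t j < a ∧ a < u ∧ 1 < cdist N a b ∧ cdist N p a < 1 := by
  have e1 : ∀ᶠ a in nhdsWithin (t j) (Set.Ioi (t j)), 1 < cdist N a b :=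
    (((continuous_cdist_left hN hc b).tendsto (t j)).eventually
      (lt_mem_nhds (ht.outer j b hb hb'))).filter_mono nhdsWithin_le_nhds
  have e2 : ∀ᶠ a in nhdsWithin (t j) (Set.Ioi (t j)), cdist N p a < 1 :=
    (((continuous_cdist_right hN hc p).tendsto (t j)).eventually
      (gt_mem_nhds hp)).filter_mono nhdsWithin_le_nhds
  have e3 : ∀ᶠ a in nhdsWithin (t j) (Set.Ioi (t j)), a ∈ Set.Ioo (t j) u :=
    Ioo_mem_nhdsGT hu
  obtain ⟨a, h1, h2, h3⟩ := (e1.and (e2.and e3)).exists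
  exact ⟨a, h3.1, h3.2, h1, h2⟩

theorem IsHexAngles.cdist_le_one (hN : ∀ x, N x = 0 → x = 0) {t : ℕ → ℝ} (ht : IsHexAngles N t)
    {j : ℕ} {α β : ℝ} (h1 : t j ≤ α) (h2 : α ≤ β) (h3 : β ≤ t (j + 1)) : cdist N α β ≤ 1 := by
  have hpi : t (j + 1) < t j + π := by
    rw [← ht.add_three]; exact (ht.lt_succ _).trans (ht.lt_succ _)
  rw [← ht.cdist_succ j]
  exact (cdist_mono_right hN h2 h3 (by linarith)).trans
    (cdist_mono_left hN h1 (h2.trans h3) hpi.le)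

/-- The cycle starts at the vertex `t 0`; one further point is placed after `t 0`, two after each of
`t 1, …, t 4`, and one after `t 5`. Of two points on one arc, the first is close to its predecessor
and the second is needed for the next arc. -/
theorem IsHexAngles.exists_isTightCycle_eleven (hN : ∀ x, N x = 0 → x = 0) (hc : Continuous N)
    {t : ℕ → ℝ} (ht : IsHexAngles N t) : ∃ x, IsTightCycle N (· ≤ 1) 11 x := by
  have l0 := ht.lt_succ 0
  have l1 := ht.lt_succ 1
  have l2 := ht.lt_succ 2
  have l3 := ht.lt_succ 3
  have l4 := ht.lt_succ 4
  have l5 := ht.lt_succ 5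
  have a0 := ht.add_three 0
  have a1 := ht.add_three 1
  have a2 := ht.add_three 2
  have a3 := ht.add_three 3
  norm_num at l0 l1 l2 l3 l4 l5 a0 a1 a2 a3
  have hself : ∀ j, cdist N (t j) (t j) < 1 := fun j => by rw [cdist_self]; norm_num
  -- The choices run backwards, since each point must be far from the one two places later. The odd
  -- points come first; the even ones, which also must be close to the preceding odd point, follow
  -- from `x10`, for which `x1` one turn later is already known.
  obtain ⟨x9, p9, q9, f9, -⟩ := ht.exists_near hN hc (j := 4) (b := t 6) (hself 4)
    (by norm_num; linarith) (by linarith) (by linarith : t 4 < t 5)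
  obtain ⟨x7, p7, q7, f7, -⟩ := ht.exists_near hN hc (j := 3) (b := x9) (hself 3)
    (by norm_num; linarith) (by linarith) (by linarith : t 3 < t 4)
  obtain ⟨x5, p5, q5, f5, -⟩ := ht.exists_near hN hc (j := 2) (b := x7) (hself 2)
    (by norm_num; linarith) (by linarith) (by linarith : t 2 < t 3)
  obtain ⟨x3, p3, q3, f3, -⟩ := ht.exists_near hN hc (j := 1) (b := x5) (hself 1)
    (by norm_num; linarith) (by linarith) (by linarith : t 1 < t 2)
  obtain ⟨x1, p1, q1, f1, -⟩ := ht.exists_near hN hc (j := 0) (b := x3) (hself 0)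
    (by norm_num; linarith) (by linarith) (by linarith : t 0 < t 1)
  obtain ⟨x10, p10, q10, f10, c10⟩ := ht.exists_near hN hc (j := 5) (b := x1 + 2 * π)
    (ht.inner 4 x9 p9 q9.le) (by norm_num; linarith) (by linarith) (by linarith : t 5 < t 6)
  obtain ⟨x8, p8, q8, f8, c8⟩ := ht.exists_near hN hc (j := 4) (b := x10)
    (ht.inner 3 x7 p7 q7.le) (by norm_num; linarith) (by linarith) p9
  obtain ⟨x6, p6, q6, f6, c6⟩ := ht.exists_near hN hc (j := 3) (b := x8)
    (ht.inner 2 x5 p5 q5.le) (by norm_num; linarith) (by linarith) p7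
  obtain ⟨x4, p4, q4, f4, c4⟩ := ht.exists_near hN hc (j := 2) (b := x6)
    (ht.inner 1 x3 p3 q3.le) (by norm_num; linarith) (by linarith) p5
  obtain ⟨x2, p2, q2, f2, c2⟩ := ht.exists_near hN hc (j := 1) (b := x4)
    (ht.inner 0 x1 p1 q1.le) (by norm_num; linarith) (by linarith) p3
  refine exists_isTightCycle_of_full_turn (m := 11) (by norm_num)
    (y := fun i => [t 0, x1, x2, x3, x4, x5, x6, x7, x8, x9, x10, t 6, x1 + 2 * π].getD i 0)
    ?_ ?_ ?_ ?_ ?_ ?_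
  · intro i hi
    interval_cases i <;> simp <;> linarith
  · intro i hi
    interval_cases i <;> simp <;> linarith
  · simp; linarith
  · simp
  · intro i hi
    interval_cases i <;> simp only [List.getD_cons_zero, List.getD_cons_succ, Nat.reduceAdd]
    · exact ht.cdist_le_one hN (j := 0) le_rfl p1.le q1.le
    · exact c2.le
    · exact ht.cdist_le_one hN (j := 1) p2.le q2.le q3.le
    · exact c4.le
    · exact ht.cdist_le_one hN (j := 2) p4.le q4.le q5.le
    · exact c6.le
    · exact ht.cdist_le_one hN (j := 3) p6.le q6.le q7.le
    · exact c8.le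
    · exact ht.cdist_le_one hN (j := 4) p8.le q8.le q9.le
    · exact c10.le
    · exact ht.cdist_le_one hN (j := 5) p10.le q10.le le_rfl
  · intro i hi
    rw [not_le]
    interval_cases i <;> simp only [List.getD_cons_zero, List.getD_cons_succ, Nat.reduceAdd]
    · exact ht.outer 0 x2 p2 (by linarith)
    all_goals assumption

/-- The vertices of the tight hexagon are interlaced with those of a second unit hexagon, turned
slightly forward. Vectors two apart are adjacent vertices of one hexagon, at distance exactly one,
which is not close in the strict sense. -/
theorem IsHexAngles.exists_isTightCycle_twelve (hN : ∀ x, N x = 0 → x = 0) (hc : Continuous N)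
    {t : ℕ → ℝ} (ht : IsHexAngles N t) : ∃ x, IsTightCycle N (· < 1) 12 x := by
  have l0 := ht.lt_succ 0
  have l1 := ht.lt_succ 1
  have l2 := ht.lt_succ 2
  have l3 := ht.lt_succ 3
  have a0 := ht.add_three 0
  have a1 := ht.add_three 1
  norm_num at l0 l1 l2 l3 a0 a1
  have hself : ∀ j, cdist N (t j) (t j) < 1 := fun j => by rw [cdist_self]; norm_num
  obtain ⟨c5, p5, q5, -, d5⟩ := ht.exists_near hN hc (j := 2) (b := t 4) (hself 2)
    (by norm_num; linarith) (by linarith) l2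
  obtain ⟨c3, p3, q3, f3, d3⟩ := ht.exists_near hN hc (j := 1) (b := c5) (hself 1)
    (by norm_num; linarith) (by linarith) l1
  obtain ⟨x1, p1, q1, f1, d1⟩ := ht.exists_near hN hc (j := 0) (b := c3) (hself 0)
    (by norm_num; linarith) (by linarith) l0
  have hx1 : cdist N x1 (t 1) < 1 := ht.inner 0 x1 p1 q1.le
  obtain ⟨x3, ⟨h3, h3'⟩, e3⟩ := intermediate_value_Ioo p3.le
    (continuous_cdist_right hN hc x1).continuousOn ⟨hx1, f1⟩
  have hcr : 0 < cross (circ N x1) (circ N x3) := cross_circ_pos hN (by linarith) (by linarith)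
  have nu : N (circ N x3 - circ N x1) = 1 := by rw [map_sub_rev]; exact e3
  obtain ⟨x5, h5, h5', c5'⟩ := exists_circ_eq_of_cross_pos hN (α := x3) nu (by
    rw [show cross (circ N x3) (circ N x3 - circ N x1) = cross (circ N x1) (circ N x3) by
      simp [cross]; ring]
    exact hcr)
  have h5'' : x5 < x1 + π := by
    refine lt_of_cross_circ_pos hN (by linarith) ?_
    rw [c5', circ_add_pi, show cross (circ N x3 - circ N x1) (-circ N x1) =
      cross (circ N x1) (circ N x3) by simp [cross]; ring]
    exact hcr
  have e5 : cdist N x3 x5 = 1 := by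
    rw [cdist, c5', sub_sub_cancel, seminorm_circ hN]
  have e6 : cdist N x5 (x1 + π) = 1 := by
    rw [cdist, c5', circ_add_pi, sub_neg_eq_add, sub_add_cancel, seminorm_circ hN]
  -- The third vertex of the second hexagon is determined by the other two, so its position has to
  -- be derived. It is beyond `t 2`, as otherwise it would be too near to `x3`, and before `c5`, as
  -- `c3` is already farther than one from `c5`.
  have h52 : t 2 < x5 := by
    by_contra! hle
    have := (cdist_mono_right hN h5.le hle (by linarith)).trans_lt
      (ht.inner 1 x3 h3 (by norm_num; linarith))
    linarith
  have h53 : x5 < c5 := by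
    by_contra! hle
    have g1 := cdist_mono_right hN (by linarith : x3 ≤ c5) hle h5'.le
    have g2 := cdist_mono_left hN h3'.le (by linarith : c3 ≤ c5) (by linarith)
    linarith
  refine exists_isTightCycle_of_half_turn (m := 6) (by norm_num)
    (y := fun i => [t 0, x1, t 1, x3, t 2, x5, t 3, x1 + π].getD i 0) ?_ ?_ ?_ ?_ ?_
  · intro i hi
    interval_cases i <;> simp <;> linarith
  · simp; linarith
  · simp
  · intro i hi
    interval_cases i <;> simp only [List.getD_cons_zero, List.getD_cons_succ, Nat.reduceAdd]
    · exact d1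
    · exact hx1
    · exact (cdist_mono_right hN h3.le h3'.le (by linarith)).trans_lt d3
    · exact ht.inner 1 x3 h3 (by norm_num; linarith)
    · exact (cdist_mono_right hN h52.le h53.le (by linarith)).trans_lt d5
    · exact ht.inner 2 x5 h52 (by norm_num; linarith)
  · intro i hi
    rw [not_lt]
    interval_cases i <;> simp only [List.getD_cons_zero, List.getD_cons_succ, Nat.reduceAdd]
    · exact (ht.cdist_succ 0).ge
    · exact e3.ge
    · exact (ht.cdist_succ 1).ge
    · exact e5.ge
    · exact (ht.cdist_succ 2).ge
    · exact e6.ge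

theorem IsMaxNorm.seminorm_sub {d f : Plane} (h : IsMaxNorm N d f) (a b a' b' : ℝ) :
    N (a • d + b • f - (a' • d + b' • f)) = max |a - a'| |b - b'| := by
  rw [← h.eq_max]; congr 1; module

theorem cross_comb (d f : Plane) (a b a' b' : ℝ) :
    cross (a • d + b • f) (a' • d + b' • f) = (a * b' - b * a') * cross d f := by
  simp [cross]; ring

/-- A half turn of points of the boundary of a parallelogram that are given by their coordinates
yields a tight cycle. -/
theorem IsMaxNorm.exists_isTightCycle (hN : ∀ x, N x = 0 → x = 0) {d f : Plane}
    (h : IsMaxNorm N d f) {m : ℕ} (hm : 2 ≤ m) {a b : ℕ → ℝ} (hu : ∀ i < m, max |a i| |b i| = 1)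
    (ha0 : a m = -a 0) (hb0 : b m = -b 0) (ha1 : a (m + 1) = -a 1) (hb1 : b (m + 1) = -b 1)
    (hpos : ∀ i < m, 0 < i → 0 < a 0 * b i - b 0 * a i)
    (hturn : ∀ i < m, 0 < a i * b (i + 1) - b i * a (i + 1))
    (close : ∀ i < m, r (max |a i - a (i + 1)| |b i - b (i + 1)|))
    (far : ∀ i < m, ¬ r (max |a i - a (i + 2)| |b i - b (i + 2)|)) :
    ∃ x, IsTightCycle N r (m + m) x := by
  let v : ℕ → Plane := fun i => a i • d + b i • f
  have hv : ∀ i < m, N (v i) = 1 := fun i hi => by rw [h.eq_max, hu i hi]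
  have hcr : ∀ i j, cross (v i) (v j) = (a i * b j - b i * a j) * cross d f := fun i j =>
    cross_comb d f _ _ _ _
  have c0 : circ N (polarAngle (v 0)) = v 0 := circ_polarAngle (hv 0 (by omega))
  set θ := polarAngle (v 0) with hθ
  have hex : ∀ i, ∃ β, (i = 0 → β = θ) ∧ (0 < i → i < m → θ < β ∧ β < θ + π) ∧
      (i < m → circ N β = v i) := by
    intro i
    by_cases hi : 0 < i ∧ i < m
    · obtain ⟨β, h1, h2, h3⟩ := exists_circ_eq_of_cross_pos hN (α := θ) (hv i hi.2) (by
        rw [c0, hcr]; exact mul_pos (hpos i hi.2 hi.1) h.cross_pos)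
      exact ⟨β, fun h0 => absurd h0 hi.1.ne', fun _ _ => ⟨h1, h2⟩, fun _ => h3⟩
    · refine ⟨θ, fun _ => rfl, fun h1 h2 => absurd ⟨h1, h2⟩ hi, fun h2 => ?_⟩
      rw [show i = 0 by omega, c0]
  choose β hβ0 hβ1 hβ2 using hex
  let y : ℕ → ℝ := fun i => if i < m then β i else β (i - m) + π
  have y1 : ∀ i < m, y i = β i := fun i hi => if_pos hi
  have ym : y m = y 0 + π := by
    simp only [y, lt_irrefl, if_false, Nat.sub_self, if_pos (by omega : 0 < m)]
  have ym1 : y (m + 1) = y 1 + π := by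
    simp only [y, if_neg (by omega : ¬ m + 1 < m), Nat.add_sub_cancel_left,
      if_pos (by omega : 1 < m)]
  have hy : ∀ i < m + 2, circ N (y i) = v i := by
    intro i hi
    rcases lt_or_ge i m with h1 | h1
    · rw [y1 i h1, hβ2 i h1]
    · obtain rfl | rfl : i = m ∨ i = m + 1 := by omega
      · rw [ym, circ_add_pi, y1 0 (by omega), hβ2 0 (by omega)]
        simp only [v, ha0, hb0]; module
      · rw [ym1, circ_add_pi, y1 1 (by omega), hβ2 1 (by omega)]
        simp only [v, ha1, hb1]; module
  have hd : ∀ i < m + 2, ∀ j < m + 2, cdist N (y i) (y j) = max |a i - a j| |b i - b j| := by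
    intro i hi j hj
    rw [cdist, hy i hi, hy j hj, h.seminorm_sub]
  have hbound : ∀ i ≤ m, θ ≤ y i ∧ y i ≤ θ + π ∧ (i < m → y i < θ + π) := by
    intro i hi
    rcases hi.eq_or_lt with rfl | hi
    · rw [ym, y1 0 (by omega), hβ0 0 rfl]
      exact ⟨by linarith [pi_pos], le_rfl, fun h => absurd h (lt_irrefl _)⟩
    · rw [y1 i hi]
      rcases Nat.eq_zero_or_pos i with rfl | h0
      · rw [hβ0 0 rfl]; exact ⟨le_rfl, by linarith [pi_pos], fun _ => by linarith [pi_pos]⟩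
      · have := hβ1 i h0 hi
        exact ⟨this.1.le, this.2.le, fun _ => this.2⟩
  refine exists_isTightCycle_of_half_turn hm (y := y) (fun i hi => ?_) ym ym1 (fun i hi => ?_)
    fun i hi => ?_
  · refine lt_of_cross_circ_pos hN (N := N) ?_ ?_
    · have h1 := (hbound i hi.le).2.2 hi
      have h2 := (hbound (i + 1) hi).1
      linarith
    · rw [hy i (by omega), hy (i + 1) (by omega), hcr]
      exact mul_pos (hturn i hi) h.cross_pos
  · rw [hd i (by omega) (i + 1) (by omega)]; exact close i hi
  · rw [hd i (by omega) (i + 2) (by omega)]; exact far i hi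

/-- Two points divide each side of the square into thirds: neighbours are at distance `2 / 3`,
points two apart at distance `4 / 3`. -/
theorem IsMaxNorm.exists_isTightCycle_eight (hN : ∀ x, N x = 0 → x = 0) {d f : Plane}
    (h : IsMaxNorm N d f) : ∃ x, IsTightCycle N (· ≤ 1) 8 x := by
  refine h.exists_isTightCycle hN (m := 4) (by norm_num)
    (a := fun i => [1, 1, 1 / 3, -1 / 3, -1, -1].getD i 0)
    (b := fun i => [-1 / 3, 1 / 3, 1, 1, 1 / 3, -1 / 3].getD i 0)
    ?_ (by simp) (by simp; norm_num) (by simp) (by simp; norm_num) ?_ ?_ ?_ ?_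
  · intro i hi
    interval_cases i <;> simp [abs_div] <;> norm_num
  · intro i hi h0
    interval_cases i <;> simp <;> norm_num
  · intro i hi
    interval_cases i <;> simp <;> norm_num
  · intro i hi
    interval_cases i <;> simp [abs_le] <;> norm_num
  · intro i hi
    rw [not_le]
    interval_cases i <;> simp [lt_abs] <;> norm_num

/-- The midpoint and the two quarter points of each side, without the corners: neighbours are at
distance `1 / 2`, points two apart at distance exactly 1. -/
theorem IsMaxNorm.exists_isTightCycle_twelve (hN : ∀ x, N x = 0 → x = 0) {d f : Plane}
    (h : IsMaxNorm N d f) : ∃ x, IsTightCycle N (· < 1) 12 x := by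
  refine h.exists_isTightCycle hN (m := 6) (by norm_num)
    (a := fun i => [1, 1, 1 / 2, 0, -1 / 2, -1, -1, -1].getD i 0)
    (b := fun i => [0, 1 / 2, 1, 1, 1, 1 / 2, 0, -1 / 2].getD i 0)
    ?_ (by simp) (by simp) (by simp) (by simp; norm_num) ?_ ?_ ?_ ?_
  · intro i hi
    interval_cases i <;> simp [abs_div] <;> norm_num
  · intro i hi h0
    interval_cases i <;> simp
  · intro i hi
    interval_cases i <;> simp <;> norm_num
  · intro i hi
    interval_cases i <;> simp [abs_lt] <;> norm_num
  · intro i hi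
    rw [not_lt]
    interval_cases i <;> simp [le_abs] <;> norm_num

end

section

/-! ### From convex discs to norms -/

variable {C : Set Plane} {N : Seminorm ℝ Plane}

/-- `N` is the norm whose unit ball is the difference body of `C`. -/
structure IsBodyNorm (C : Set Plane) (N : Seminorm ℝ Plane) : Prop where
  eq_zero : ∀ x, N x = 0 → x = 0
  continuous : Continuous N
  le_one_iff : ∀ v, N v ≤ 1 ↔ v ∈ C - C
  lt_one_iff : ∀ v, N v < 1 ↔ v ∈ interior C - interior C

/-- The norm is the gauge of the difference body. -/
theorem IsConvexDisc.exists_isBodyNorm (hC : IsConvexDisc C) : ∃ N, IsBodyNorm C N := by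
  have hconv : Convex ℝ (C - C) := hC.convex.sub hC.convex
  have hcomp : IsCompact (C - C) := by
    rw [sub_eq_add_neg]; exact hC.isCompact.add hC.isCompact.neg
  obtain ⟨c, hc⟩ := hC.interior_nonempty
  have hopen : IsOpen (interior C - interior C) := isOpen_interior.sub_right
  have hsub : interior C - interior C ⊆ C - C := Set.sub_subset_sub interior_subset interior_subset
  have hnhds : C - C ∈ nhds (0 : Plane) :=
    Filter.mem_of_superset (hopen.mem_nhds ⟨c, hc, c, hc, sub_self c⟩) hsub
  have hbal : Balanced ℝ (C - C) := by
    rw [balanced_iff_neg_mem hconv]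
    rintro _ ⟨a, ha, b, hb, rfl⟩
    exact ⟨b, hb, a, ha, (neg_sub a b).symm⟩
  have habs : Absorbent ℝ (C - C) := absorbent_nhds_zero hnhds
  refine ⟨gaugeSeminorm hbal hconv habs, fun x hx => ?_, continuous_gauge hconv hnhds,
    fun v => ?_, fun v => ?_⟩
  · exact (gauge_eq_zero habs (NormedSpace.isVonNBounded_iff ℝ |>.2 hcomp.isBounded)).1 hx
  · change gauge (C - C) v ≤ 1 ↔ _
    rw [gauge_le_one_iff_mem_closure hconv hnhds, hcomp.isClosed.closure_eq]
  · change gauge (C - C) v < 1 ↔ _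
    constructor
    · intro h
      -- A vector of norm below one is `t • (a - b)` with `t < 1`; shrinking `a` and `b` towards the
      -- same interior point `c` keeps this difference and moves both into the interior.
      obtain ⟨t, ht0, ht1, z, ⟨a, ha, b, hb, rfl⟩, rfl⟩ := exists_lt_of_gauge_lt habs h
      refine ⟨t • a + (1 - t) • c, ?_, t • b + (1 - t) • c, ?_, ?_⟩
      · exact hC.convex.combo_self_interior_mem_interior ha hc ht0.le (by linarith) (by ring)
      · exact hC.convex.combo_self_interior_mem_interior hb hc ht0.le (by linarith) (by ring)
      · simp only [smul_sub]; abel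
    · intro h
      exact interior_subset_gauge_lt_one _ (interior_maximal hsub hopen h)

theorem inter_vadd_nonempty_iff {A : Set Plane} {v w : Plane} :
    ((v +ᵥ A) ∩ (w +ᵥ A)).Nonempty ↔ v - w ∈ A - A := by
  constructor
  · rintro ⟨_, ⟨a, ha, rfl⟩, b, hb, e⟩
    refine ⟨b, hb, a, ha, ?_⟩
    simp only [vadd_eq_add] at e
    rw [sub_eq_sub_iff_add_eq_add, add_comm, e, add_comm]
  · rintro ⟨b, hb, a, ha, e⟩
    refine ⟨v + a, ⟨a, ha, rfl⟩, b, hb, ?_⟩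
    simp only [vadd_eq_add]
    rw [sub_eq_sub_iff_add_eq_add] at e
    rw [add_comm, e]

theorem IsBodyNorm.overlap_iff (h : IsBodyNorm C N) {v w : Plane} :
    Overlap (v +ᵥ C) (w +ᵥ C) ↔ N (v - w) < 1 := by
  rw [h.lt_one_iff, Overlap, interior_vadd, interior_vadd, inter_vadd_nonempty_iff]

theorem IsBodyNorm.not_disjoint_iff (h : IsBodyNorm C N) {v w : Plane} :
    ¬ Disjoint (v +ᵥ C) (w +ᵥ C) ↔ N (v - w) ≤ 1 := by
  rw [h.le_one_iff, Set.not_disjoint_iff_nonempty_inter, inter_vadd_nonempty_iff]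

theorem IsBodyNorm.touch_iff (h : IsBodyNorm C N) {v : Plane} : Touch (v +ᵥ C) C ↔ N v = 1 := by
  have h1 := h.overlap_iff (v := v) (w := 0)
  have h2 := inter_vadd_nonempty_iff (A := C) (v := v) (w := 0)
  rw [zero_vadd, sub_zero] at h1 h2
  rw [Touch, h1, h2, ← h.le_one_iff, not_lt, le_antisymm_iff]

theorem IsBodyNorm.isDualHadwigerFamily_eq (h : IsBodyNorm C N) :
    IsDualHadwigerFamily C = IsLinked N (· ≤ 1) := by
  funext F
  rw [← isFamily_iff_isLinked h.eq_zero (fun a b hab hb => hab.trans hb) (by norm_num), eq_iff_iff]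
  exact ⟨fun hF => ⟨fun v hv => h.touch_iff.1 (hF.touch v hv),
      fun v w hvw => h.not_disjoint_iff.1 (hF.consecutive v w hvw), hF.origin_mem⟩,
    fun hF => ⟨fun v hv => h.touch_iff.2 (hF.unit v hv),
      fun v w hvw => h.not_disjoint_iff.2 (hF.consecutive v w hvw), hF.origin_mem⟩⟩

theorem IsBodyNorm.isStrictDualHadwigerFamily_eq (h : IsBodyNorm C N) :
    IsStrictDualHadwigerFamily C = IsLinked N (· < 1) := by
  funext F
  rw [← isFamily_iff_isLinked h.eq_zero (fun a b hab hb => hab.trans_lt hb) (by norm_num),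
    eq_iff_iff]
  exact ⟨fun hF => ⟨fun v hv => h.touch_iff.1 (hF.touch v hv),
      fun v w hvw => h.overlap_iff.1 (hF.consecutive v w hvw), hF.origin_mem⟩,
    fun hF => ⟨fun v hv => h.touch_iff.2 (hF.unit v hv),
      fun v w hvw => h.overlap_iff.2 (hF.consecutive v w hvw), hF.origin_mem⟩⟩

theorem isGreatest_card_minimal (hN : ∀ x, N x = 0 → x = 0) {r : ℝ → Prop}
    (hr : ∀ a b, a ≤ b → r b → r a) {m : ℕ} (hex : ∃ x, IsTightCycle N r m x)
    (hle : ∀ n x, IsTightCycle N r n x → n ≤ m) :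
    IsGreatest {k : ℕ | ∃ F : Finset Plane, Minimal (IsLinked N r) F ∧ F.card = k} m := by
  constructor
  · obtain ⟨x, hx⟩ := hex
    exact ⟨_, hx.minimal hN hr, hx.toIsCyclic.card hN⟩
  · rintro _ ⟨F, hF, rfl⟩
    obtain ⟨x, hx⟩ := exists_isTightCycle hN hr hF
    exact hle _ x hx

theorem IsBodyNorm.isDualBlockingNumber (h : IsBodyNorm C N) {m : ℕ}
    (hex : ∃ x, IsTightCycle N (· ≤ 1) m x) (hle : ∀ n x, IsTightCycle N (· ≤ 1) n x → n ≤ m) :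
    IsDualBlockingNumber C m := by
  rw [IsDualBlockingNumber, h.isDualHadwigerFamily_eq]
  exact isGreatest_card_minimal h.eq_zero (fun a b hab hb => hab.trans hb) hex hle

theorem IsBodyNorm.isStrictDualBlockingNumber (h : IsBodyNorm C N) {m : ℕ}
    (hex : ∃ x, IsTightCycle N (· < 1) m x) (hle : ∀ n x, IsTightCycle N (· < 1) n x → n ≤ m) :
    IsStrictDualBlockingNumber C m := by
  rw [IsStrictDualBlockingNumber, h.isStrictDualHadwigerFamily_eq]
  exact isGreatest_card_minimal h.eq_zero (fun a b hab hb => hab.trans_lt hb) hex hle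

/-! ### Parallelograms -/

theorem linearIndependent_iff_cross_ne_zero {e : Fin 2 → Plane} :
    LinearIndependent ℝ e ↔ cross (e 0) (e 1) ≠ 0 := by
  rw [Fintype.linearIndependent_iff]
  simp only [Fin.sum_univ_two, Fin.forall_fin_two]
  constructor
  · intro h hcr
    unfold cross at hcr
    have h1 := h ![e 1 0, -e 0 0] (by
      ext i; fin_cases i <;> simp <;> linarith)
    have h2 := h ![e 1 1, -e 0 1] (by
      ext i; fin_cases i <;> simp <;> linarith)
    simp at h1 h2
    have h3 := h ![1, 0] (by ext i; fin_cases i <;> simp [h1.2, h2.2])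
    simp at h3
  · intro hcr g hg
    have e0 := congrArg (fun v : Plane => v 0) hg
    have e1 := congrArg (fun v : Plane => v 1) hg
    simp at e0 e1
    unfold cross at hcr
    constructor
    · apply (mul_eq_zero.1 (?_ : g 0 * _ = 0)).resolve_right hcr
      linear_combination (e 1 1) * e0 - (e 1 0) * e1
    · apply (mul_eq_zero.1 (?_ : g 1 * _ = 0)).resolve_right hcr
      linear_combination (e 0 0) * e1 - (e 0 1) * e0

theorem mem_parallelogram_iff {p : Plane} {e : Fin 2 → Plane} {v : Plane} :
    v ∈ p +ᵥ parallelepiped e ↔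
      ∃ s t : ℝ, 0 ≤ s ∧ s ≤ 1 ∧ 0 ≤ t ∧ t ≤ 1 ∧ v = p + (s • e 0 + t • e 1) := by
  rw [Set.mem_vadd_set]
  constructor
  · rintro ⟨w, hw, rfl⟩
    obtain ⟨g, hg, rfl⟩ := (mem_parallelepiped_iff _ _).1 hw
    exact ⟨g 0, g 1, hg.1 0, hg.2 0, hg.1 1, hg.2 1, by rw [Fin.sum_univ_two, vadd_eq_add]⟩
  · rintro ⟨s, t, hs, hs', ht, ht', rfl⟩
    refine ⟨_, (mem_parallelepiped_iff _ _).2 ⟨![s, t], ⟨?_, ?_⟩, rfl⟩, ?_⟩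
    · intro i; fin_cases i <;> simpa
    · intro i; fin_cases i <;> simpa
    · simp [Fin.sum_univ_two]

theorem eq_of_comb_eq {d f : Plane} (h : cross d f ≠ 0) {a b a' b' : ℝ}
    (e : a • d + b • f = a' • d + b' • f) : a = a' ∧ b = b' := by
  have h1 := congrArg (fun v => cross v f) e
  have h2 := congrArg (fun v => cross d v) e
  have e1 : ∀ a b : ℝ, cross (a • d + b • f) f = a * cross d f := fun a b => by
    simp [cross]; ring
  have e2 : ∀ a b : ℝ, cross d (a • d + b • f) = b * cross d f := fun a b => by
    simp [cross]; ring
  simp only [e1, e2] at h1 h2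
  exact ⟨mul_right_cancel₀ h h1, mul_right_cancel₀ h h2⟩

theorem exists_comb_eq {d f : Plane} (h : cross d f ≠ 0) (v : Plane) :
    ∃ a b : ℝ, v = a • d + b • f := by
  refine ⟨cross v f / cross d f, cross d v / cross d f, ?_⟩
  have : cross d f • v = cross v f • d + cross d v • f := by
    ext i; fin_cases i <;> simp [cross] <;> ring
  rw [div_eq_inv_mul, div_eq_inv_mul, mul_smul, mul_smul, ← smul_add, ← this, smul_smul,
    inv_mul_cancel₀ h, one_smul]

theorem IsBodyNorm.exists_isMaxNorm (h : IsBodyNorm C N) (hp : IsParallelogram C) :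
    ∃ d f, IsMaxNorm N d f := by
  obtain ⟨p, e, he, rfl⟩ := hp
  have hcr := linearIndependent_iff_cross_ne_zero.1 he
  have hin : ∀ a b : ℝ, N (a • e 0 + b • e 1) ≤ 1 → |a| ≤ 1 ∧ |b| ≤ 1 := by
    intro a b hab
    obtain ⟨u, hu, w, hw, huw⟩ := (h.le_one_iff _).1 hab
    obtain ⟨s, t, hs, hs', ht, ht', rfl⟩ := mem_parallelogram_iff.1 hu
    obtain ⟨s', t', k, k', l, l', rfl⟩ := mem_parallelogram_iff.1 hw
    have huw : p + (s • e 0 + t • e 1) - (p + (s' • e 0 + t' • e 1)) = a • e 0 + b • e 1 := huw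
    obtain ⟨rfl, rfl⟩ := eq_of_comb_eq hcr (a := s - s') (b := t - t') (by rw [← huw]; module)
    exact ⟨abs_le.2 ⟨by linarith, by linarith⟩, abs_le.2 ⟨by linarith, by linarith⟩⟩
  have hout : ∀ s t s' t' : ℝ, 0 ≤ s → s ≤ 1 → 0 ≤ t → t ≤ 1 → 0 ≤ s' → s' ≤ 1 → 0 ≤ t' → t' ≤ 1 →
      N ((s - s') • e 0 + (t - t') • e 1) ≤ 1 := by
    intro s t s' t' hs hs' ht ht' k k' l l'
    refine (h.le_one_iff _).2 ⟨p + (s • e 0 + t • e 1),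
      mem_parallelogram_iff.2 ⟨s, t, hs, hs', ht, ht', rfl⟩, p + (s' • e 0 + t' • e 1),
      mem_parallelogram_iff.2 ⟨s', t', k, k', l, l', rfl⟩, ?_⟩
    change p + (s • e 0 + t • e 1) - (p + (s' • e 0 + t' • e 1)) = _
    module
  have hge : ∀ z, (∀ c : ℝ, N (c • z) ≤ 1 → |c| ≤ 1) → 1 ≤ N z := by
    intro z hz
    by_contra! hlt
    obtain ⟨s, hs1, hs2⟩ := exists_between (max_lt hlt (zero_lt_one))
    have hs0 : 0 < s := (le_max_right _ _).trans_lt hs1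
    have := hz (1 / s) (by
      rw [seminorm_smul_of_nonneg N (by positivity), one_div, inv_mul_le_one₀ hs0]
      exact (le_max_left _ _).trans hs1.le)
    rw [abs_of_pos (by positivity), div_le_one hs0] at this
    linarith
  have n0 : N (e 0) = 1 := le_antisymm (by simpa using hout 1 0 0 0) (hge _ fun c hc =>
    (hin c 0 (by simpa using hc)).1)
  have n1 : N (e 1) = 1 := le_antisymm (by simpa using hout 0 1 0 0) (hge _ fun c hc =>
    (hin 0 c (by simpa using hc)).2)
  have n2 : N (e 1 + e 0) ≤ 1 := by rw [add_comm]; simpa using hout 1 1 0 0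
  have n3 : N (e 1 - e 0) ≤ 1 := by
    rw [sub_eq_neg_add]; simpa using hout 0 1 1 0
  rcases lt_or_gt_of_ne hcr with hneg | hpos
  · refine ⟨e 1, e 0, ?_, seminorm_eq_max N n1 n0 (by rwa [add_comm]) (by rwa [map_sub_rev])⟩
    have : cross (e 1) (e 0) = -cross (e 0) (e 1) := by simp [cross]; ring
    rw [this]; linarith
  · exact ⟨e 0, e 1, hpos, seminorm_eq_max N n0 n1 n2 n3⟩

/-- In the coordinates of `d, f`, the set `C` has width at most one in both directions, while the
differences `d + f` and `-d + f` occur between its points. The first pair pins `C` inside a unit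
square with these two points as opposite corners; the second pair must then be the other two
corners, and convexity fills the square. -/
theorem IsBodyNorm.isParallelogram (h : IsBodyNorm C N) (hC : Convex ℝ C) {d f : Plane}
    (hm : IsMaxNorm N d f) : IsParallelogram C := by
  have hcr : cross d f ≠ 0 := hm.cross_pos.ne'
  obtain ⟨c1, hc1, c0, hc0, e10⟩ := (h.le_one_iff ((1 : ℝ) • d + (1 : ℝ) • f)).1
    (by rw [hm.eq_max]; simp)
  obtain ⟨c3, hc3, c2, hc2, e32⟩ := (h.le_one_iff ((-1 : ℝ) • d + (1 : ℝ) • f)).1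
    (by rw [hm.eq_max]; simp)
  replace e10 : c1 - c0 = (1 : ℝ) • d + (1 : ℝ) • f := e10
  replace e32 : c3 - c2 = (-1 : ℝ) • d + (1 : ℝ) • f := e32
  have hco : ∀ a b a' b' : ℝ, c0 + (a • d + b • f) ∈ C → c0 + (a' • d + b' • f) ∈ C →
      |a - a'| ≤ 1 ∧ |b - b'| ≤ 1 := by
    intro a b a' b' hab hab'
    have := (h.le_one_iff _).2 ⟨_, hab, _, hab', rfl⟩
    change N (c0 + (a • d + b • f) - (c0 + (a' • d + b' • f))) ≤ 1 at this
    rw [add_sub_add_left_eq_sub, hm.seminorm_sub] at this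
    exact max_le_iff.1 this
  have h0 : c0 + ((0 : ℝ) • d + (0 : ℝ) • f) ∈ C := by simpa using hc0
  have h1 : c0 + ((1 : ℝ) • d + (1 : ℝ) • f) ∈ C := by rw [← e10]; simpa using hc1
  have hbox : ∀ a b : ℝ, c0 + (a • d + b • f) ∈ C → 0 ≤ a ∧ a ≤ 1 ∧ 0 ≤ b ∧ b ≤ 1 := by
    intro a b hab
    obtain ⟨k0, l0⟩ := hco a b 0 0 hab h0
    obtain ⟨k1, l1⟩ := hco a b 1 1 hab h1
    rw [abs_le] at k0 l0 k1 l1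
    exact ⟨by linarith, by linarith, by linarith, by linarith⟩
  obtain ⟨a, b, hab⟩ := exists_comb_eq hcr (c2 - c0)
  have e2 : c2 = c0 + (a • d + b • f) := by rw [← hab]; abel
  have e3 : c3 = c0 + ((a - 1) • d + (b + 1) • f) := by
    rw [← sub_add_cancel c3 c2, e32, e2]; module
  have k2 := hbox a b (e2 ▸ hc2)
  have k3 := hbox (a - 1) (b + 1) (e3 ▸ hc3)
  obtain rfl : a = 1 := by linarith
  obtain rfl : b = 0 := by linarith
  refine ⟨c0, ![d, f], linearIndependent_iff_cross_ne_zero.2 hcr, ?_⟩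
  ext v
  rw [mem_parallelogram_iff]
  constructor
  · intro hv
    obtain ⟨a, b, hab⟩ := exists_comb_eq hcr (v - c0)
    have ev : v = c0 + (a • d + b • f) := by rw [← hab]; abel
    obtain ⟨l1, l2, l3, l4⟩ := hbox a b (ev ▸ hv)
    exact ⟨a, b, l1, l2, l3, l4, ev⟩
  · rintro ⟨s, t, hs, hs', ht, ht', rfl⟩
    have m0 := hC hc0 hc2 (sub_nonneg.2 hs') hs (sub_add_cancel 1 s)
    have m1 := hC hc3 hc1 (sub_nonneg.2 hs') hs (sub_add_cancel 1 s)
    have m := hC m0 m1 (sub_nonneg.2 ht') ht (sub_add_cancel 1 t)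
    have e1 : c1 = c0 + ((1 : ℝ) • d + (1 : ℝ) • f) := by rw [← e10]; abel
    rw [e1, e2, e3] at m
    convert m using 1
    simp only [Matrix.cons_val_zero, Matrix.cons_val_one]
    module

end

end DualBlocking

end

theorem mainTheorem5 (C : Set DualBlocking.Plane) (hC : DualBlocking.IsConvexDisc C) :
    (¬ DualBlocking.IsParallelogram C →
      DualBlocking.IsDualBlockingNumber C 11 ∧ DualBlocking.IsStrictDualBlockingNumber C 12) ∧
    (DualBlocking.IsParallelogram C →
      DualBlocking.IsDualBlockingNumber C 8 ∧ DualBlocking.IsStrictDualBlockingNumber C 12) := by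
  obtain ⟨N, h⟩ := hC.exists_isBodyNorm
  have hN := h.eq_zero
  constructor
  · intro hp
    obtain ⟨t, ht⟩ := DualBlocking.exists_isHexAngles hN h.continuous
      fun ⟨d, f, hm⟩ => hp (h.isParallelogram hC.convex hm)
    exact ⟨h.isDualBlockingNumber (ht.exists_isTightCycle_eleven hN h.continuous)
        fun n x hx => hx.le_eleven hN,
      h.isStrictDualBlockingNumber (ht.exists_isTightCycle_twelve hN h.continuous)
        fun n x hx => hx.le_twelve_of_isHexAngles hN ht⟩
  · intro hp
    obtain ⟨d, f, hm⟩ := h.exists_isMaxNorm hp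
    obtain ⟨τ, hτ⟩ := hm.exists_isQuadAngles hN
    exact ⟨h.isDualBlockingNumber (hm.exists_isTightCycle_eight hN)
        fun n x hx => hx.le_eight_of_isQuadAngles hN hτ,
      h.isStrictDualBlockingNumber (hm.exists_isTightCycle_twelve hN)
        fun n x hx => hx.le_twelve_of_isQuadAngles hN hτ⟩
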